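/- Let $A:\mathbb R\to\mathbb R^{n\times n}$ be piecewise continuous (finitely many discontinuities in every bounded interval, finite one-sided limits everywhere) and periodic of period $T>0$, and let $B\in\mathbb R^{n\times n}$ be nonsingular. Assume that every characteristic exponent of $A(\cdot)$, i.e. every $\mu\in\mathbb C$ for which $\dot x=A(t)x$ has a nonzero complex solution of the form $e^{\mu t}p(t)$ with $p$ periodic of period $T$, satisfies $\operatorname{Re}\mu\le 0$. For $t\ge 0$ let $\mathcal G(t)$ be a weighted digraph on $N$ nodes without self-cycles ($a_{kk}(t)=0$), with weights $a_{kj}(t)\in\{0\}\cup[\eta,\gamma]$ for fixed $0<\eta\le\gamma$, and let its Laplacian $L(t)$, with $l_{kk}=\sum_i a_{ki}$ and $l_{kj}=-a_{kj}$ for $j\neq k$, be piecewise continuous and bounded on $[0,\infty)$. Assume that $\mathcal G$ is uniformly connected: there are $S>0$, $\delta>0$ and a node $k$ such that for every $t\ge0$ and every node $j\ne k$ there is a path $j=i_0,i_1,\dots,i_m=k$ with $\int_t^{t+S}a_{i_{l}i_{l+1}}(\tau)\,d\tau\ge\delta$ for $0\le l<m$. Then the control law $$u_k=B^{-1}\sum_{j=1}^N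 a_{kj}(t)(x_j-x_k),\qquad k=1,\dots,N,$$ exponentially synchronizes all solutions of $\dot x_k=A(t)x_k+Bu_k$, $k=1,\dots,N$, to a solution of $\dot x_0=A(t)x_0$. That is, there are constants $c,d>0$ such that for every $t_0\ge 0$ and every solution $(x_1,\dots,x_N)$ of the closed-loop system on $[t_0,\infty)$ there is a solution $x_0$ of $\dot x_0=A(t)x_0$ on $[t_0,\infty)$ with $$\Big(\sum_{k=1}^N\|x_k(t)-x_0(t)\|^2\Big)^{1/2}\le c\,e^{-d(t-t_0)}\Big(\sum_{k=1}^N\|x_k(t_0)-x_0(t_0)\|^2\Big)^{1/2}\qquad\text{for all }t\ge t_0,$$ and moreover $u_k(t)\to0$ as $t\to\infty$ for every $k$. Solutions are understood in the integrated sense, $x(t)=x(s)+\int_s^t\dot x(\tau)\,d\tau$ with $x$ continuous. -/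

import Mathlib

open Set Filter Topology MeasureTheory
open scoped Matrix

noncomputable section

/-- `f` is piecewise continuous on `I`: every bounded interval contains only finitely many
discontinuities of `f` in `I`, and `f` has (finite) one-sided limits at every point of `I`. -/
def PiecewiseContinuousOn {E : Type*} [TopologicalSpace E] (f : ℝ → E) (I : Set ℝ) : Prop :=
  (∀ b c : ℝ, {t | t ∈ I ∩ Icc b c ∧ ¬ ContinuousWithinAt f I t}.Finite) ∧
  ∀ t ∈ I, (∃ l, Tendsto f (𝓝[I ∩ Iio t] t) (𝓝 l)) ∧ (∃ l, Tendsto f (𝓝[I ∩ Ioi t] t) (𝓝 l))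

/-- `x` solves `x' = f t x` on the interval `I`, in the (usual) integrated sense that is appropriate
for right-hand sides which are discontinuous in time. -/
def IsSolutionOn {E : Type*} [NormedAddCommGroup E] [NormedSpace ℝ E]
    (f : ℝ → E → E) (I : Set ℝ) (x : ℝ → E) : Prop :=
  ContinuousOn x I ∧ ∀ s ∈ I, ∀ t ∈ I,
    IntervalIntegrable (fun τ => f τ (x τ)) volume s t ∧
      x t = x s + ∫ τ in s..t, f τ (x τ)

/-- `μ` is a characteristic (Floquet) exponent of the `T`-periodic matrix `A(·)`: the system
`x' = A(t) x` has a nonzero complex solution `exp(μ t) p(t)` with `p` periodic of period `T`. -/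
def IsCharacteristicExponent {n : ℕ} (A : ℝ → Matrix (Fin n) (Fin n) ℝ) (T : ℝ) (μ : ℂ) : Prop :=
  ∃ p : ℝ → Fin n → ℂ, Function.Periodic p T ∧ p ≠ 0 ∧
    IsSolutionOn (fun t (z : Fin n → ℂ) => (A t).map (Complex.ofReal) *ᵥ z) univ
      (fun t => Complex.exp (μ * (t : ℂ)) • p t)

/-- `a t` is, for `t ≥ 0`, the weighted adjacency matrix of a digraph without self-cycles
whose weights lie in `{0} ∪ [η, γ]`, where `0 < η ≤ γ`. -/
structure IsAdjacency {N : ℕ} (a : ℝ → Matrix (Fin N) (Fin N) ℝ) (η γ : ℝ) : Prop where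
  pos : 0 < η
  le : η ≤ γ
  weight : ∀ t, 0 ≤ t → ∀ k j, a t k j = 0 ∨ a t k j ∈ Icc η γ
  diag : ∀ t, 0 ≤ t → ∀ k, a t k k = 0

/-- The Laplacian of the digraph with weighted adjacency matrix `a`. -/
def graphLaplacian {N : ℕ} (a : Matrix (Fin N) (Fin N) ℝ) : Matrix (Fin N) (Fin N) ℝ :=
  fun k j => if j = k then ∑ i, a k i else - a k j

/-- `k` receives information from `j` across `[t, t + S]`: in the digraph with weighted
adjacency matrix `∫ τ in [t, t + S], a τ`, the edge from `k` to `j` has weight at least `δ`. -/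
def EdgeAcross {N : ℕ} (a : ℝ → Matrix (Fin N) (Fin N) ℝ) (δ S t : ℝ) (k j : Fin N) : Prop :=
  δ ≤ ∫ τ in t..(t + S), a τ k j

/-- Uniform connectedness: there are a horizon `S > 0`, a threshold `δ > 0` and a node `k` such
that for all `t ≥ 0` every node has a path to `k` in the digraph integrated over `[t, t + S]`. -/
def UniformlyConnected {N : ℕ} (a : ℝ → Matrix (Fin N) (Fin N) ℝ) : Prop :=
  ∃ S > 0, ∃ δ > 0, ∃ k : Fin N, ∀ t, 0 ≤ t → ∀ j, j ≠ k →
    Relation.TransGen (EdgeAcross a δ S t) j k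

/-- The control `u_k = B⁻¹ ∑ j, a_kj (x_j - x_k)`. -/
def syncControl {N n : ℕ} (B : Matrix (Fin n) (Fin n) ℝ) (a : Matrix (Fin N) (Fin N) ℝ)
    (x : Fin N → Fin n → ℝ) (k : Fin N) : Fin n → ℝ :=
  B⁻¹ *ᵥ ∑ j, a k j • (x j - x k)

/-- The right-hand side of the closed-loop system `x_k' = A(t) x_k + B u_k`. -/
def closedLoop {N n : ℕ} (A : ℝ → Matrix (Fin n) (Fin n) ℝ) (B : Matrix (Fin n) (Fin n) ℝ)
    (a : ℝ → Matrix (Fin N) (Fin N) ℝ) (t : ℝ) (x : Fin N → Fin n → ℝ) : Fin N → Fin n → ℝ :=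
  fun k => A t *ᵥ x k + B *ᵥ syncControl B (a t) x k

/-- The Euclidean norm of the stacked vector `[x_1; …; x_N]`. -/
def stackNorm {N n : ℕ} (x : Fin N → Fin n → ℝ) : ℝ :=
  Real.sqrt (∑ k, ∑ i, x k i ^ 2)

end

/-! The coupling multiplies states by scalar weights, so it commutes with every matrix, and B
cancels B⁻¹. Let Φ be the fundamental solution of the free system and Ψ its inverse. In the
coordinates y_k(t) = Φ(t₀)Ψ(t)x_k(t) the drift disappears, and each component solves the scalar
consensus system w_k' = ∑ a_kj (w_j - w_k) (`IsFundamentalPair.isConsensusSolution`).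

Scalar consensus converges exponentially. The minimum of the states never falls and the maximum
never rises. If the root node lies in the upper half of the range, its height above the minimum
spreads to one more node in each window of length S, so after N windows the minimum has risen by a
fixed fraction of the range; the other case is symmetric. The range therefore contracts by a fixed
factor (`sub_le_contraction`), which gives a common limit and a rate d that do not depend on the
initial time.

Returning to x costs the factor Φ(t)Ψ(t₀). By Floquet theory the eigenvalues of the monodromy matrix
lie in the closed unit disc, so by Gelfand's formula this factor grows more slowly than every
exponential (`exists_fundamentalPair_transition_bound`). Polynomial growth is possible, so a rate
d/2 is given up to absorb it, leaving decay at rate d/2. The controls vanish because the weights are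
bounded and the differences of the states tend to zero. -/

/-! ### Monotonicity with countably many exceptional times -/

/-- A continuous function whose derivative is negative off a countable set does not increase. -/
theorem image_le_of_hasDerivAt_neg_off_countable {g g' : ℝ → ℝ} {a b : ℝ} {D : Set ℝ}
    (hD : D.Countable) (hab : a ≤ b) (hg : ContinuousOn g (Icc a b))
    (hd : ∀ t ∈ Ioo a b \ D, HasDerivAt g (g' t) t) (hneg : ∀ t ∈ Ioo a b \ D, g' t < 0) :
    g b ≤ g a := by
  by_contra! hlt
  -- The level c avoids the countable image of D, so the last time t with g t ≤ c lies outside D.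
  -- There g crosses c upwards, and the right-hand slopes contradict the negative derivative.
  obtain ⟨c, hc, hcD⟩ : (Ioo (g a) (g b) \ g '' D).Nonempty := by
    by_contra hne
    rw [not_nonempty_iff_eq_empty, sdiff_eq_empty] at hne
    exact (Cardinal.Real.Ioo_countable_iff.not.2 (not_le.2 hlt)) ((hD.image g).mono hne)
  set s := Icc a b ∩ g ⁻¹' Iic c with hs
  have hclosed : IsClosed s := hg.preimage_isClosed_of_isClosed isClosed_Icc isClosed_Iic
  have hbdd : BddAbove s := ⟨b, fun x hx => hx.1.2⟩
  have hmem : sSup s ∈ s := hclosed.csSup_mem ⟨a, ⟨left_mem_Icc.2 hab, hc.1.le⟩⟩ hbdd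
  set t := sSup s
  have htb : t < b := lt_of_le_of_ne hmem.1.2 fun h => by
    have := hmem.2; rw [h] at this; exact absurd hc.2 (not_lt.2 this)
  have hgt : ∀ x ∈ Ioc t b, c < g x := fun x hx => by
    by_contra! h
    exact absurd (le_csSup hbdd (show x ∈ s from ⟨⟨hmem.1.1.trans hx.1.le, hx.2⟩, h⟩))
      (not_le.2 hx.1)
  have hgtc : g t = c := by
    refine le_antisymm hmem.2 ?_
    have hcont : Tendsto g (𝓝[Ioc t b] t) (𝓝 (g t)) :=
      (hg t hmem.1).mono_left (nhdsWithin_mono _ fun x hx => ⟨hmem.1.1.trans hx.1.le, hx.2⟩)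
    have : (𝓝[Ioc t b] t).NeBot := by
      rw [nhdsWithin_Ioc_eq_nhdsGT htb]; infer_instance
    exact ge_of_tendsto hcont (eventually_mem_nhdsWithin.mono fun x hx => (hgt x hx).le)
  have hta : a < t := lt_of_le_of_ne hmem.1.1 fun h => by
    rw [← h] at hgtc; exact absurd hc.1 (by rw [hgtc]; exact lt_irrefl _)
  have htD : t ∉ D := fun h => hcD ⟨t, h, hgtc⟩
  have htm : t ∈ Ioo a b \ D := ⟨⟨hta, htb⟩, htD⟩
  have hslope := (hasDerivAt_iff_tendsto_slope.1 (hd t htm)).mono_left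
    (nhdsWithin_mono t (fun x (hx : x ∈ Ioi t) => ne_of_gt hx))
  have hnn : 0 ≤ g' t := by
    refine ge_of_tendsto hslope ?_
    filter_upwards [Ioc_mem_nhdsGT htb] with x hx
    rw [slope_def_field]
    exact div_nonneg (by rw [hgtc]; linarith [hgt x hx]) (by linarith [hx.1])
  exact absurd (hneg t htm) (not_lt.2 hnn)

/-- A continuous function whose derivative is nonpositive off a countable set does not increase. -/
theorem image_le_of_hasDerivAt_nonpos_off_countable {g g' : ℝ → ℝ} {a b : ℝ} {D : Set ℝ}
    (hD : D.Countable) (hab : a ≤ b) (hg : ContinuousOn g (Icc a b))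
    (hd : ∀ t ∈ Ioo a b \ D, HasDerivAt g (g' t) t) (hneg : ∀ t ∈ Ioo a b \ D, g' t ≤ 0) :
    g b ≤ g a := by
  have key : ∀ ε > 0, g b - ε * b ≤ g a - ε * a := fun ε hε =>
    image_le_of_hasDerivAt_neg_off_countable (g := fun t => g t - ε * t)
      (g' := fun t => g' t - ε * 1) hD hab (hg.sub (by fun_prop))
      (fun t ht => (hd t ht).sub ((hasDerivAt_id t).const_mul ε))
      (fun t ht => by have := hneg t ht; linarith)
  refine le_of_forall_pos_le_add fun ε hε => ?_
  -- The summand 1 keeps the denominator positive when a = b.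
  have h := key (ε / (b - a + 1)) (by apply div_pos hε; linarith)
  have : ε / (b - a + 1) * (b - a) ≤ ε := by
    rw [div_mul_eq_mul_div, div_le_iff₀ (by linarith)]; nlinarith
  linarith

/-- A continuous function whose derivative is nonnegative off a countable set does not decrease. -/
theorem le_image_of_hasDerivAt_nonneg_off_countable {g g' : ℝ → ℝ} {a b : ℝ} {D : Set ℝ}
    (hD : D.Countable) (hab : a ≤ b) (hg : ContinuousOn g (Icc a b))
    (hd : ∀ t ∈ Ioo a b \ D, HasDerivAt g (g' t) t) (hneg : ∀ t ∈ Ioo a b \ D, 0 ≤ g' t) :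
    g a ≤ g b := by
  have := image_le_of_hasDerivAt_nonpos_off_countable (g := fun t => - g t)
    (g' := fun t => - g' t) hD hab hg.neg (fun t ht => (hd t ht).neg)
    (fun t ht => by linarith [hneg t ht])
  linarith

theorem eq_of_hasDerivAt_zero_off_countable {E : Type*} [NormedAddCommGroup E] [NormedSpace ℝ E]
    [CompleteSpace E] {f : ℝ → E} {D : Set ℝ} (hD : D.Countable) (hf : Continuous f)
    (hd : ∀ t ∉ D, HasDerivAt f 0 t) (s t : ℝ) : f s = f t := by
  have := integral_eq_of_hasDerivAt_off_countable f (fun _ => 0) (a := s) (b := t) hD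
    hf.continuousOn (fun x hx => hd x hx.2) (by simp)
  simp only [intervalIntegral.integral_zero] at this
  exact (sub_eq_zero.1 this.symm).symm

/-! ### Piecewise continuous functions: boundedness and measurability -/

theorem PiecewiseContinuousOn.countable_discontinuities {E : Type*} [TopologicalSpace E]
    {f : ℝ → E} {I : Set ℝ} (hf : PiecewiseContinuousOn f I) :
    {t | t ∈ I ∧ ¬ ContinuousWithinAt f I t}.Countable := by
  refine (countable_iUnion fun m : ℕ => (hf.1 (-m) m).countable).mono fun t ht => ?_
  obtain ⟨m, hm⟩ := exists_nat_ge |t|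
  exact mem_iUnion.2 ⟨m, ⟨ht.1, abs_le.1 hm⟩, ht.2⟩

theorem PiecewiseContinuousOn.exists_norm_le_of_isCompact {E : Type*} [SeminormedAddCommGroup E]
    {f : ℝ → E} (hf : PiecewiseContinuousOn f univ) {K : Set ℝ} (hK : IsCompact K) :
    ∃ C, ∀ t ∈ K, ‖f t‖ ≤ C := by
  refine hK.induction_on (p := fun s => ∃ C, ∀ t ∈ s, ‖f t‖ ≤ C) ⟨0, by simp⟩
    (fun s t hst ⟨C, h⟩ => ⟨C, fun x hx => h x (hst hx)⟩)
    (fun s t ⟨C, h⟩ ⟨C', h'⟩ => ⟨max C C', fun x hx => hx.elim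
      (fun h1 => (h x h1).trans (le_max_left _ _)) (fun h1 => (h' x h1).trans (le_max_right _ _))⟩)
    fun x _ => ?_
  obtain ⟨⟨l, hl⟩, ⟨r, hr⟩⟩ := hf.2 x (mem_univ x)
  rw [univ_inter] at hl hr
  have h1 := hl.norm.eventually (eventually_le_nhds (lt_add_one ‖l‖))
  have h2 := hr.norm.eventually (eventually_le_nhds (lt_add_one ‖r‖))
  rw [eventually_nhdsWithin_iff] at h1 h2
  refine ⟨{t | ‖f t‖ ≤ max (max (‖l‖ + 1) (‖r‖ + 1)) ‖f x‖}, mem_nhdsWithin_of_mem_nhds ?_,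
    ⟨_, fun t ht => ht⟩⟩
  filter_upwards [h1, h2] with t ht1 ht2
  rcases lt_trichotomy t x with h | h | h
  · exact (ht1 h).trans ((le_max_left _ _).trans (le_max_left _ _))
  · subst h; exact le_max_right _ _
  · exact (ht2 h).trans ((le_max_right _ _).trans (le_max_left _ _))

theorem PiecewiseContinuousOn.exists_norm_le_of_periodic {E : Type*} [SeminormedAddCommGroup E]
    {f : ℝ → E} (hf : PiecewiseContinuousOn f univ) {T : ℝ} (hT : 0 < T)
    (hper : Function.Periodic f T) : ∃ C, ∀ t, ‖f t‖ ≤ C := by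
  obtain ⟨C, hC⟩ := hf.exists_norm_le_of_isCompact (isCompact_Icc (a := 0) (b := T))
  refine ⟨C, fun t => ?_⟩
  obtain ⟨s, hs, hst⟩ := hper.exists_mem_Ico₀ hT t
  rw [hst]; exact hC s ⟨hs.1, hs.2.le⟩

theorem aestronglyMeasurable_of_continuousAt_off_countable {E : Type*} [TopologicalSpace E]
    [TopologicalSpace.PseudoMetrizableSpace E] {f : ℝ → E} {D U : Set ℝ}
    (hU : MeasurableSet U)
    (hD : D.Countable) (hf : ∀ t ∈ U \ D, ContinuousAt f t) :
    AEStronglyMeasurable f (volume.restrict U) := by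
  have h1 : AEStronglyMeasurable f (volume.restrict (U \ D)) :=
    ContinuousOn.aestronglyMeasurable (fun t ht => (hf t ht).continuousWithinAt)
      (hU.diff hD.measurableSet)
  have : volume.restrict (U \ D) = volume.restrict U :=
    Measure.restrict_congr_set (sdiff_null_ae_eq_self (hD.measure_zero volume))
  rwa [this] at h1

/-! ### Global existence for linear differential equations -/

/-- The factor 1/K makes the Picard map a contraction on the whole line in the norm weighted by
exp(-K|t|). -/
theorem abs_integral_exp_mul_abs_le {K : ℝ} (hK : 0 < K) (t : ℝ) :
    |∫ τ in (0 : ℝ)..t, Real.exp (K * |τ|)| ≤ Real.exp (K * |t|) / K := by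
  have pos : ∀ s : ℝ, 0 ≤ s →
      |∫ τ in (0 : ℝ)..s, Real.exp (K * |τ|)| ≤ Real.exp (K * |s|) / K := by
    intro s hs
    have h1 : ∫ τ in (0 : ℝ)..s, Real.exp (K * |τ|) = ∫ τ in (0 : ℝ)..s, Real.exp (K * τ) := by
      refine intervalIntegral.integral_congr fun τ hτ => ?_
      rw [uIcc_of_le hs] at hτ
      simp only [abs_of_nonneg hτ.1]
    have h2 : ∫ τ in (0 : ℝ)..s, Real.exp (K * τ) = Real.exp (K * s) / K - 1 / K := by
      rw [intervalIntegral.integral_comp_mul_left _ hK.ne', integral_exp]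
      simp [smul_eq_mul]; ring
    have h3 : 1 ≤ Real.exp (K * s) := Real.one_le_exp (by positivity)
    rw [h1, h2, abs_of_nonneg hs, abs_of_nonneg]
    · linarith [div_pos one_pos hK]
    · rw [← sub_div]; exact div_nonneg (by linarith) hK.le
  rcases le_total 0 t with h | h
  · exact pos t h
  · have := pos (-t) (by linarith)
    have h4 : ∫ τ in (0 : ℝ)..t, Real.exp (K * |τ|) = - ∫ τ in (0 : ℝ)..(-t), Real.exp (K * |τ|) := by
      have := intervalIntegral.integral_comp_neg (a := 0) (b := t) (fun τ => Real.exp (K * |τ|))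
      simp only [abs_neg, neg_zero] at this
      rw [this, intervalIntegral.integral_symm]
    rw [h4, abs_neg, ← abs_neg t]; exact this

theorem intervalIntegrable_of_continuousAt_off_countable {E : Type*}
    [NormedAddCommGroup E] {f : ℝ → E} {D : Set ℝ} {a b C : ℝ}
    (hD : D.Countable) (hf : ∀ t ∈ uIoc a b \ D, ContinuousAt f t)
    (hb : ∀ t ∈ uIoc a b, ‖f t‖ ≤ C) : IntervalIntegrable f volume a b := by
  rw [intervalIntegrable_iff]
  refine IntegrableOn.of_bound (by rw [uIoc]; exact measure_Ioc_lt_top)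
    (aestronglyMeasurable_of_continuousAt_off_countable measurableSet_uIoc hD hf) C ?_
  exact (ae_restrict_iff' measurableSet_uIoc).2 (Eventually.of_forall hb)

/-- A linear differential equation whose bounded coefficient is continuous off a countable set has
a solution on the whole line. -/
theorem exists_linear_ode_solution {E : Type*} [NormedAddCommGroup E]
    [NormedSpace ℝ E] [CompleteSpace E] {L : ℝ → E →L[ℝ] E} {D : Set ℝ} (hD : D.Countable)
    (hL : ∀ t ∉ D, ContinuousAt L t) {M : ℝ} (hM : ∀ t, ‖L t‖ ≤ M) (v : E) :
    ∃ X : ℝ → E, Continuous X ∧ X 0 = v ∧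
      (∀ s t, IntervalIntegrable (fun τ => L τ (X τ)) volume s t) ∧
      (∀ t ∉ D, HasDerivAt X (L t (X t)) t) := by
  have hint : ∀ z : ℝ → E, Continuous z → ∀ s t,
      IntervalIntegrable (fun τ => L τ (z τ)) volume s t := by
    intro z hz s t
    obtain ⟨C, hC⟩ := (isCompact_uIcc (a := s) (b := t)).exists_bound_of_continuousOn hz.continuousOn
    refine intervalIntegrable_of_continuousAt_off_countable (C := M * C) hD
      (fun τ hτ => (hL τ hτ.2).clm_apply hz.continuousAt) fun τ hτ => ?_
    exact ((L τ).le_opNorm _).trans (mul_le_mul (hM τ) (hC τ (uIoc_subset_uIcc hτ))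
      (norm_nonneg _) ((norm_nonneg _).trans (hM 0)))
  have hM0 : 0 ≤ M := (norm_nonneg _).trans (hM 0)
  -- This gives M/K ≤ 1/2, the contraction constant; the summand 1 keeps K positive when M = 0.
  set K : ℝ := 2 * (M + 1) with hKdef
  have hK : 0 < K := by positivity
  have hwc : Continuous fun τ : ℝ => Real.exp (K * |τ|) := by fun_prop
  have hest : ∀ (z : ℝ → E) (C : ℝ), (∀ τ, ‖z τ‖ ≤ C) → ∀ t,
      ‖∫ τ in (0 : ℝ)..t, L τ (Real.exp (K * |τ|) • z τ)‖ ≤ Real.exp (K * |t|) * (C / 2) := by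
    intro z C hC t
    have hC0 : 0 ≤ C := (norm_nonneg _).trans (hC 0)
    have h1 : ‖∫ τ in (0 : ℝ)..t, L τ (Real.exp (K * |τ|) • z τ)‖ ≤
        |∫ τ in (0 : ℝ)..t, (M * C) * Real.exp (K * |τ|)| := by
      refine intervalIntegral.norm_integral_le_abs_of_norm_le (Eventually.of_forall fun τ => ?_)
        ((hwc.const_mul _).intervalIntegrable _ _)
      refine ((L τ).le_opNorm _).trans ?_
      rw [norm_smul, Real.norm_eq_abs, Real.abs_exp]
      calc ‖L τ‖ * (Real.exp (K * |τ|) * ‖z τ‖) ≤ M * (Real.exp (K * |τ|) * C) := by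
            gcongr
            exacts [hM τ, hC τ]
        _ = _ := by ring
    refine h1.trans ?_
    rw [intervalIntegral.integral_const_mul, abs_mul, abs_of_nonneg (mul_nonneg hM0 hC0)]
    refine (mul_le_mul_of_nonneg_left (abs_integral_exp_mul_abs_le hK t) (by positivity)).trans ?_
    rw [mul_div_assoc', div_le_iff₀ hK, hKdef]
    nlinarith [mul_nonneg hC0 (Real.exp_pos (K * |t|)).le]
  have hexp : ∀ t : ℝ, Real.exp (-(K * |t|)) * Real.exp (K * |t|) = 1 := fun t => by
    rw [← Real.exp_add]; simp
  have hexp1 : ∀ t : ℝ, Real.exp (-(K * |t|)) ≤ 1 := fun t =>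
    Real.exp_le_one_iff.2 (neg_nonpos.2 (by positivity))
  -- The Picard map in the rescaled unknown z(t) = exp(-K|t|) X(t), which is bounded although X may
  -- grow.
  let F : BoundedContinuousFunction ℝ E → BoundedContinuousFunction ℝ E := fun z =>
    BoundedContinuousFunction.ofNormedAddCommGroup
      (fun t => Real.exp (-(K * |t|)) • (v + ∫ τ in (0 : ℝ)..t, L τ (Real.exp (K * |τ|) • z τ)))
      (by
        refine Continuous.smul (by fun_prop) (continuous_const.add ?_)
        exact intervalIntegral.continuous_primitive
          (hint (fun τ => Real.exp (K * |τ|) • z τ) (hwc.smul z.continuous)) 0)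
      (‖v‖ + ‖z‖ / 2)
      (by
        intro t
        rw [norm_smul, Real.norm_eq_abs, Real.abs_exp]
        have h2 := hest z ‖z‖ z.norm_coe_le_norm t
        calc _ ≤ Real.exp (-(K * |t|)) * (‖v‖ + Real.exp (K * |t|) * (‖z‖ / 2)) := by
              gcongr; exact (norm_add_le _ _).trans (by gcongr)
          _ = Real.exp (-(K * |t|)) * ‖v‖ + ‖z‖ / 2 := by rw [mul_add, ← mul_assoc, hexp]; ring
          _ ≤ _ := by
            have := mul_le_mul_of_nonneg_right (hexp1 t) (norm_nonneg v)
            linarith)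
  have hF : ContractingWith (1 / 2) F := by
    refine ⟨by norm_num, LipschitzWith.of_dist_le_mul fun z w => ?_⟩
    refine (BoundedContinuousFunction.dist_le (by positivity)).2 fun t => ?_
    have e1 : F z t - F w t = Real.exp (-(K * |t|)) •
        ∫ τ in (0 : ℝ)..t, L τ (Real.exp (K * |τ|) • (z - w) τ) := by
      have : ∀ τ, L τ (Real.exp (K * |τ|) • (z - w) τ) =
          L τ (Real.exp (K * |τ|) • z τ) - L τ (Real.exp (K * |τ|) • w τ) := fun τ => by
        rw [← map_sub, ← smul_sub]; rfl
      simp_rw [this]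
      rw [intervalIntegral.integral_sub (hint (fun τ => Real.exp (K * |τ|) • z τ)
        (hwc.smul z.continuous) _ _) (hint (fun τ => Real.exp (K * |τ|) • w τ)
        (hwc.smul w.continuous) _ _)]
      change Real.exp (-(K * |t|)) • (v + ∫ τ in (0 : ℝ)..t, L τ (Real.exp (K * |τ|) • z τ)) -
        Real.exp (-(K * |t|)) • (v + ∫ τ in (0 : ℝ)..t, L τ (Real.exp (K * |τ|) • w τ)) = _
      rw [← smul_sub]; congr 1; abel
    rw [dist_eq_norm, e1, norm_smul, Real.norm_eq_abs, Real.abs_exp, dist_eq_norm]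
    have h2 := hest (fun τ => (z - w) τ) ‖z - w‖ (z - w).norm_coe_le_norm t
    calc _ ≤ Real.exp (-(K * |t|)) * (Real.exp (K * |t|) * (‖z - w‖ / 2)) := by gcongr
      _ = ‖z - w‖ / 2 := by rw [← mul_assoc, hexp, one_mul]
      _ ≤ _ := by norm_num; linarith
  let z := ContractingWith.fixedPoint F hF
  have hz : F z = z := hF.fixedPoint_isFixedPt
  have hzt : ∀ t, Real.exp (K * |t|) • z t =
      v + ∫ τ in (0 : ℝ)..t, L τ (Real.exp (K * |τ|) • z τ) := fun t => by
    have : z t = Real.exp (-(K * |t|)) • (v + ∫ τ in (0 : ℝ)..t, L τ (Real.exp (K * |τ|) • z τ)) := by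
      conv_lhs => rw [← hz]
      rfl
    conv_lhs => rw [this]
    rw [smul_smul, mul_comm, hexp, one_smul]
  have hXc : Continuous fun t => Real.exp (K * |t|) • z t := hwc.smul z.continuous
  refine ⟨fun t => Real.exp (K * |t|) • z t, hXc, (hzt 0).trans (by simp), hint _ hXc, fun t ht => ?_⟩
  have hd := intervalIntegral.integral_hasDerivAt_right (hint _ hXc 0 t)
    ⟨univ, univ_mem, aestronglyMeasurable_of_continuousAt_off_countable MeasurableSet.univ hD
      (fun τ hτ => (hL τ hτ.2).clm_apply hXc.continuousAt)⟩
    ((hL t ht).clm_apply hXc.continuousAt)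
  exact ((hd.const_add v).congr_of_eventuallyEq (Eventually.of_forall hzt))

/-! ### Fundamental solutions and periodicity -/

/-- `Φ` is the solution of `X' = A X`, `X 0 = 1` on the line and `Ψ` its inverse; the differential
equations hold off `D`. -/
structure IsFundamentalPair {𝔸 : Type*} [NormedRing 𝔸] [NormedAlgebra ℝ 𝔸]
    (A : ℝ → 𝔸) (D : Set ℝ) (Φ Ψ : ℝ → 𝔸) : Prop where
  continuous_left : Continuous Φ
  continuous_right : Continuous Ψ
  left_zero : Φ 0 = 1
  mul_right : ∀ t, Φ t * Ψ t = 1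
  mul_left : ∀ t, Ψ t * Φ t = 1
  hasDerivAt_left : ∀ t ∉ D, HasDerivAt Φ (A t * Φ t) t
  hasDerivAt_right : ∀ t ∉ D, HasDerivAt Ψ (-(Ψ t * A t)) t
  intervalIntegrable : ∀ s t, IntervalIntegrable (fun τ => A τ * Φ τ) volume s t

section
variable {𝔸 : Type*} [NormedRing 𝔸] [NormedAlgebra ℝ 𝔸] [CompleteSpace 𝔸]

/-- Ψ is constructed from the adjoint equation Y' = -YA, so that ΨΦ has zero derivative and stays 1.
Dedekind finiteness turns this left inverse into a two-sided one. -/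
theorem exists_isFundamentalPair [IsDedekindFiniteMonoid 𝔸] {A : ℝ → 𝔸} {D : Set ℝ}
    (hD : D.Countable) (hA : ∀ t ∉ D, ContinuousAt A t) {M : ℝ} (hM : ∀ t, ‖A t‖ ≤ M) :
    ∃ Φ Ψ : ℝ → 𝔸, IsFundamentalPair A D Φ Ψ := by
  obtain ⟨Φ, hΦc, hΦ0, hΦi, hΦd⟩ := exists_linear_ode_solution
    (L := fun t => ContinuousLinearMap.mul ℝ 𝔸 (A t)) (M := M) hD
    (fun t ht => (ContinuousLinearMap.mul ℝ 𝔸).continuous.continuousAt.comp (hA t ht))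
    (fun t => (ContinuousLinearMap.opNorm_mul_apply_le ℝ 𝔸 _).trans (hM t)) 1
  obtain ⟨Ψ, hΨc, hΨ0, hΨi, hΨd⟩ := exists_linear_ode_solution
    (L := fun t => (ContinuousLinearMap.mul ℝ 𝔸).flip (-A t))
    (M := ‖(ContinuousLinearMap.mul ℝ 𝔸).flip‖ * M) hD
    (fun t ht => (ContinuousLinearMap.mul ℝ 𝔸).flip.continuous.continuousAt.comp (hA t ht).neg)
    (fun t => ((ContinuousLinearMap.mul ℝ 𝔸).flip.le_opNorm _).trans
      (by rw [norm_neg]; exact mul_le_mul_of_nonneg_left (hM t) (norm_nonneg _))) 1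
  simp only [ContinuousLinearMap.mul_apply', ContinuousLinearMap.flip_apply, mul_neg] at *
  have hone : ∀ t, Ψ t * Φ t = 1 := fun t => by
    have := eq_of_hasDerivAt_zero_off_countable (f := fun t => Ψ t * Φ t) hD (hΨc.mul hΦc)
      (fun t ht => by
        have h := (hΨd t ht).mul (hΦd t ht)
        rwa [neg_mul, mul_assoc, neg_add_cancel] at h) t 0
    rw [this, hΨ0, hΦ0, one_mul]
  exact ⟨Φ, Ψ, hΦc, hΨc, hΦ0, fun t => mul_eq_one_symm (hone t), hone, hΦd, hΨd, hΦi⟩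

namespace IsFundamentalPair
variable {A : ℝ → 𝔸} {D : Set ℝ} {Φ Ψ : ℝ → 𝔸} {T : ℝ}

theorem comp_clm_eq_add_integral {E : Type*} [NormedAddCommGroup E] [NormedSpace ℝ E]
    [CompleteSpace E] (h : IsFundamentalPair A D Φ Ψ) (hD : D.Countable) (ℓ : 𝔸 →L[ℝ] E)
    (s t : ℝ) : IntervalIntegrable (fun τ => ℓ (A τ * Φ τ)) volume s t ∧
      ℓ (Φ t) = ℓ (Φ s) + ∫ τ in s..t, ℓ (A τ * Φ τ) := by
  refine ⟨⟨ℓ.integrable_comp (h.intervalIntegrable s t).1,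
    ℓ.integrable_comp (h.intervalIntegrable s t).2⟩, ?_⟩
  rw [ℓ.intervalIntegral_comp_comm (h.intervalIntegrable s t),
    integral_eq_of_hasDerivAt_off_countable Φ _ hD h.continuous_left.continuousOn
      (fun x hx => h.hasDerivAt_left x hx.2) (h.intervalIntegrable s t), map_sub]
  abel

/-- By periodicity t ↦ Φ(t + T) solves the same equation, so Ψ(t)Φ(t + T) is constant. -/
theorem left_add_period (h : IsFundamentalPair A D Φ Ψ) (hD : D.Countable)
    (hper : Function.Periodic A T) (t : ℝ) : Φ (t + T) = Φ t * Φ T := by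
  have hD' : (D ∪ (fun t => t + T) ⁻¹' D).Countable :=
    hD.union (hD.preimage (add_left_injective T))
  have := eq_of_hasDerivAt_zero_off_countable (f := fun t => Ψ t * Φ (t + T)) hD'
    (h.continuous_right.mul (h.continuous_left.comp (continuous_id.add continuous_const)))
    (fun t ht => by
      have h1 := (h.hasDerivAt_left (t + T) fun hh => ht (Or.inr hh)).comp_add_const t T
      have h2 := (h.hasDerivAt_right t fun hh => ht (Or.inl hh)).mul h1
      rwa [hper, neg_mul, mul_assoc, neg_add_cancel] at h2) t 0
  have h0 : Ψ 0 = 1 := by simpa [h.left_zero] using h.mul_left 0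
  simp only [h0, zero_add, one_mul] at this
  rw [← this, ← mul_assoc, h.mul_right, one_mul]

theorem left_add_nat_mul_period (h : IsFundamentalPair A D Φ Ψ) (hD : D.Countable)
    (hper : Function.Periodic A T) (t : ℝ) (k : ℕ) : Φ (t + k * T) = Φ t * Φ T ^ k := by
  induction k with
  | zero => simp
  | succ k ih =>
    rw [pow_succ, ← mul_assoc, ← ih, ← h.left_add_period hD hper]; congr 1; push_cast; ring

theorem right_add_nat_mul_period (h : IsFundamentalPair A D Φ Ψ) (hD : D.Countable)
    (hper : Function.Periodic A T) (t : ℝ) (k : ℕ) : Φ T ^ k * Ψ (t + k * T) = Ψ t := by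
  have h1 := h.left_add_nat_mul_period hD hper t k
  calc Φ T ^ k * Ψ (t + k * T) = Ψ t * Φ t * Φ T ^ k * Ψ (t + k * T) := by
        rw [h.mul_left, one_mul]
    _ = Ψ t * (Φ (t + k * T) * Ψ (t + k * T)) := by rw [h1]; simp only [mul_assoc]
    _ = Ψ t := by rw [h.mul_right, mul_one]

/-- Power-boundedness of the monodromy up to an exponential of small rate bounds the transition
operator. -/
theorem exists_norm_transition_le (h : IsFundamentalPair A D Φ Ψ) (hD : D.Countable)
    (hT : 0 < T) (hper : Function.Periodic A T)
    (hpow : ∀ r : ℝ, 1 < r → ∃ C, ∀ k : ℕ, ‖Φ T ^ k‖ ≤ C * r ^ k) {ε : ℝ} (hε : 0 < ε) :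
    ∃ C > 0, ∀ s t, 0 ≤ s → s ≤ t → ‖Φ t * Ψ s‖ ≤ C * Real.exp (ε * (t - s)) := by
  obtain ⟨C, hC⟩ := hpow (Real.exp (ε * T)) (Real.one_lt_exp_iff.2 (by positivity))
  obtain ⟨C₁, hC₁⟩ := (isCompact_Icc (a := 0) (b := T)).exists_bound_of_continuousOn
    h.continuous_left.continuousOn
  obtain ⟨C₂, hC₂⟩ := (isCompact_Icc (a := 0) (b := T)).exists_bound_of_continuousOn
    h.continuous_right.continuousOn
  have hC0 : 0 ≤ C := by have := (norm_nonneg _).trans (hC 0); simpa using this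
  have hC10 : 0 ≤ C₁ := (norm_nonneg _).trans (hC₁ 0 ⟨le_rfl, hT.le⟩)
  have hC20 : 0 ≤ C₂ := (norm_nonneg _).trans (hC₂ 0 ⟨le_rfl, hT.le⟩)
  refine ⟨C₁ * C * C₂ * Real.exp (ε * T) + 1, by positivity, fun s t hs hst => ?_⟩
  have key : ∀ t : ℝ, 0 ≤ t → t - ⌊t / T⌋₊ * T ∈ Icc 0 T := fun t ht => by
    have h1 := (le_div_iff₀ hT).1 (Nat.floor_le (div_nonneg ht hT.le))
    have h2 := (div_lt_iff₀ hT).1 (Nat.lt_floor_add_one (t / T))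
    constructor <;> linarith
  set p := ⌊s / T⌋₊
  set q := ⌊t / T⌋₊
  have hpq : p ≤ q := Nat.floor_le_floor (by gcongr)
  have hps := key s hs
  have hqt := key t (hs.trans hst)
  -- Whole periods are split off both times, so Φ t * Ψ s becomes a power of the monodromy between
  -- factors evaluated in [0, T].
  have e1 : Φ t = Φ (t - q * T) * Φ T ^ (q - p) * Φ T ^ p := by
    rw [mul_assoc, ← pow_add, Nat.sub_add_cancel hpq, ← h.left_add_nat_mul_period hD hper]
    congr 1; ring
  have e2 : Φ T ^ p * Ψ s = Ψ (s - p * T) := by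
    rw [← h.right_add_nat_mul_period hD hper (s - p * T) p]; congr 2; ring
  rw [e1, mul_assoc, e2]
  have hexp : Real.exp (ε * T) ^ (q - p) ≤ Real.exp (ε * T) * Real.exp (ε * (t - s)) := by
    rw [← Real.exp_nat_mul, ← Real.exp_add, Real.exp_le_exp, Nat.cast_sub hpq]
    have : ((q : ℝ) - p) * T ≤ T + (t - s) := by linarith [hps.1, hps.2, hqt.1, hqt.2]
    nlinarith
  calc ‖Φ (t - q * T) * Φ T ^ (q - p) * Ψ (s - p * T)‖
      ≤ ‖Φ (t - q * T)‖ * ‖Φ T ^ (q - p)‖ * ‖Ψ (s - p * T)‖ := norm_mul₃_le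
    _ ≤ C₁ * (C * (Real.exp (ε * T) * Real.exp (ε * (t - s)))) * C₂ := by
        gcongr
        · exact hC₁ _ hqt
        · exact (hC _).trans (by gcongr)
        · exact hC₂ _ hps
    _ = C₁ * C * C₂ * Real.exp (ε * T) * Real.exp (ε * (t - s)) := by ring
    _ ≤ _ := by gcongr; linarith

end IsFundamentalPair

end

/-! ### Powers of the monodromy matrix and characteristic exponents -/

/-- Gelfand's formula puts ‖M ^ k‖^(1/k) eventually below r. Eigenvalues on the unit circle may be
defective, which is why r > 1 is required. -/
theorem exists_norm_pow_le_of_spectralRadius_le_one {𝔸 : Type*} [NormedRing 𝔸] [NormedAlgebra ℂ 𝔸]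
    [CompleteSpace 𝔸] {M : 𝔸} (hM : ∀ z ∈ spectrum ℂ M, ‖z‖ ≤ 1) {r : ℝ} (hr : 1 < r) :
    ∃ C, ∀ k : ℕ, ‖M ^ k‖ ≤ C * r ^ k := by
  have h1 : spectralRadius ℂ M ≤ 1 := iSup₂_le fun z hz => by exact_mod_cast hM z hz
  have h2 := (spectrum.pow_nnnorm_pow_one_div_tendsto_nhds_spectralRadius M).eventually
    (gt_mem_nhds (h1.trans_lt (show (1 : ENNReal) < ENNReal.ofReal r by
      rw [← ENNReal.ofReal_one]; exact (ENNReal.ofReal_lt_ofReal_iff (by linarith)).2 hr)))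
  obtain ⟨k₀, hk₀⟩ := eventually_atTop.1 h2
  have hr0 : 0 < r := by linarith
  -- The sum covers the finitely many early powers; going up to k₀ ensures k > 0 in the other case,
  -- where a k-th root is inverted.
  refine ⟨1 + ∑ k ∈ Finset.range (k₀ + 1), ‖M ^ k‖, fun k => ?_⟩
  have hs : 0 ≤ ∑ k ∈ Finset.range (k₀ + 1), ‖M ^ k‖ := Finset.sum_nonneg fun _ _ => norm_nonneg _
  rcases lt_or_ge k (k₀ + 1) with h | h
  · have h3 : ‖M ^ k‖ ≤ ∑ k ∈ Finset.range (k₀ + 1), ‖M ^ k‖ :=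
      Finset.single_le_sum (f := fun k => ‖M ^ k‖) (fun _ _ => norm_nonneg _) (Finset.mem_range.2 h)
    have h4 : 1 ≤ r ^ k := one_le_pow₀ hr.le
    nlinarith
  · have h3 := hk₀ k (by omega)
    have hk : (0 : ℝ) < k := by exact_mod_cast (by omega : 0 < k)
    rw [one_div, ENNReal.rpow_inv_lt_iff hk, ENNReal.rpow_natCast, ← ENNReal.ofReal_pow hr0.le,
      ← enorm_eq_nnnorm, ← ofReal_norm, ENNReal.ofReal_lt_ofReal_iff (by positivity)] at h3
    nlinarith [pow_pos hr0 k]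

attribute [local instance] Matrix.linftyOpNormedRing Matrix.linftyOpNormedAlgebra

theorem Matrix.linfty_opNorm_map_ofReal {n : ℕ} (M : Matrix (Fin n) (Fin n) ℝ) :
    ‖M.map Complex.ofReal‖ = ‖M‖ := by
  simp only [Matrix.linfty_opNorm_def, Matrix.map_apply, Complex.nnnorm_real]

theorem Matrix.map_ofReal_mul {n : ℕ} (M N : Matrix (Fin n) (Fin n) ℝ) :
    (M * N).map Complex.ofReal = M.map Complex.ofReal * N.map Complex.ofReal :=
  Matrix.map_mul (f := Complex.ofRealHom)

theorem Matrix.map_ofReal_pow {n : ℕ} (M : Matrix (Fin n) (Fin n) ℝ) (k : ℕ) :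
    (M ^ k).map Complex.ofReal = M.map Complex.ofReal ^ k :=
  map_pow (Complex.ofRealHom.mapMatrix (m := Fin n)) M k

theorem Matrix.map_ofReal_one {n : ℕ} :
    (1 : Matrix (Fin n) (Fin n) ℝ).map Complex.ofReal = 1 :=
  map_one (Complex.ofRealHom.mapMatrix (m := Fin n))

/-- Application of a real matrix to a fixed complex vector. -/
noncomputable def complexMulVecCLM {n : ℕ} (v : Fin n → ℂ) : Matrix (Fin n) (Fin n) ℝ →L[ℝ] Fin n → ℂ :=
  LinearMap.toContinuousLinearMap
    { toFun := fun M => M.map Complex.ofReal *ᵥ v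
      map_add' := fun M N => by
        rw [← Matrix.add_mulVec]; congr 1; ext i j; simp
      map_smul' := fun c M => by
        rw [RingHom.id_apply, ← Matrix.smul_mulVec]; congr 1; ext i j; simp }

/-- Application of a real matrix to a fixed real vector. -/
noncomputable def realMulVecCLM {n : ℕ} (v : Fin n → ℝ) : Matrix (Fin n) (Fin n) ℝ →L[ℝ] Fin n → ℝ :=
  LinearMap.toContinuousLinearMap
    { toFun := fun M => M *ᵥ v
      map_add' := fun M N => Matrix.add_mulVec M N v
      map_smul' := fun c M => Matrix.smul_mulVec c M v }

namespace IsFundamentalPair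
variable {n : ℕ} {A Φ Ψ : ℝ → Matrix (Fin n) (Fin n) ℝ} {D : Set ℝ} {T : ℝ}

theorem isSolutionOn_mulVec (h : IsFundamentalPair A D Φ Ψ) (hD : D.Countable) (v : Fin n → ℝ)
    (I : Set ℝ) : IsSolutionOn (fun t w => A t *ᵥ w) I (fun t => Φ t *ᵥ v) := by
  refine ⟨((realMulVecCLM v).continuous.comp h.continuous_left).continuousOn, fun s _ t _ => ?_⟩
  have := h.comp_clm_eq_add_integral hD (realMulVecCLM v) s t
  simp only [Matrix.mulVec_mulVec]
  exact this

theorem isSolutionOn_complex_mulVec (h : IsFundamentalPair A D Φ Ψ) (hD : D.Countable)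
    (v : Fin n → ℂ) (I : Set ℝ) :
    IsSolutionOn (fun t w => (A t).map Complex.ofReal *ᵥ w) I
      (fun t => (Φ t).map Complex.ofReal *ᵥ v) := by
  refine ⟨((complexMulVecCLM v).continuous.comp h.continuous_left).continuousOn,
    fun s _ t _ => ?_⟩
  have := h.comp_clm_eq_add_integral hD (complexMulVecCLM v) s t
  simp only [Matrix.mulVec_mulVec, ← Matrix.map_ofReal_mul]
  exact this

/-- For an eigenvector v of the monodromy with eigenvalue z, Φ(t)v = e^{μt}p(t) with p periodic and
e^{μT} = z. Thus μ is a characteristic exponent and log ‖z‖ = T Re μ ≤ 0. -/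
theorem norm_le_one_of_mem_spectrum (h : IsFundamentalPair A D Φ Ψ) (hD : D.Countable)
    (hT : 0 < T) (hper : Function.Periodic A T)
    (hexp : ∀ μ : ℂ, IsCharacteristicExponent A T μ → μ.re ≤ 0) {z : ℂ}
    (hz : z ∈ spectrum ℂ ((Φ T).map Complex.ofReal)) : ‖z‖ ≤ 1 := by
  rw [spectrum.mem_iff, Matrix.isUnit_iff_isUnit_det, isUnit_iff_ne_zero, not_not,
    ← Matrix.exists_mulVec_eq_zero_iff] at hz
  obtain ⟨v, hv, hzv⟩ := hz
  have hev : (Φ T).map Complex.ofReal *ᵥ v = z • v := by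
    rw [Matrix.sub_mulVec, sub_eq_zero, Algebra.algebraMap_eq_smul_one, Matrix.smul_mulVec,
      Matrix.one_mulVec] at hzv
    exact hzv.symm
  have hz0 : z ≠ 0 := by
    rintro rfl
    have : ((Ψ T).map Complex.ofReal * (Φ T).map Complex.ofReal) *ᵥ v = 0 := by
      rw [← Matrix.mulVec_mulVec, hev, zero_smul, Matrix.mulVec_zero]
    rw [← Matrix.map_ofReal_mul, h.mul_left, Matrix.map_ofReal_one, Matrix.one_mulVec] at this
    exact hv this
  have hTC : (T : ℂ) ≠ 0 := by exact_mod_cast hT.ne'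
  set μ : ℂ := Complex.log z / T with hμ
  have hμT : Complex.exp (μ * T) = z := by
    rw [hμ, div_mul_cancel₀ _ hTC, Complex.exp_log hz0]
  have hchar : IsCharacteristicExponent A T μ := by
    refine ⟨fun t => Complex.exp (-(μ * t)) • ((Φ t).map Complex.ofReal *ᵥ v), fun t => ?_, ?_, ?_⟩
    · simp only [h.left_add_period hD hper, Matrix.map_ofReal_mul, ← Matrix.mulVec_mulVec, hev,
        Matrix.mulVec_smul, smul_smul]
      congr 1
      conv_lhs => rw [← hμT]
      rw [← Complex.exp_add]; congr 1; push_cast; ring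
    · intro h0
      have := congrFun h0 0
      simp [h.left_zero] at this
      exact hv this
    · have e : (fun t : ℝ => Complex.exp (μ * t) •
          Complex.exp (-(μ * t)) • ((Φ t).map Complex.ofReal *ᵥ v)) =
          fun t => (Φ t).map Complex.ofReal *ᵥ v := by
        funext t
        rw [smul_smul, ← Complex.exp_add, add_neg_cancel, Complex.exp_zero, one_smul]
      simp only [e]
      exact h.isSolutionOn_complex_mulVec hD v univ
  have hre := hexp μ hchar
  rw [hμ, Complex.div_ofReal_re, Complex.log_re, div_nonpos_iff] at hre
  have hlog : Real.log ‖z‖ ≤ 0 := by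
    rcases hre with hh | hh
    · linarith [hh.2]
    · exact hh.1
  exact (Real.log_nonpos_iff (norm_nonneg z)).1 hlog

end IsFundamentalPair

/-- If no characteristic exponent has positive real part, the transition matrices of a periodic
system grow slower than every exponential, uniformly in the initial time. -/
theorem exists_fundamentalPair_transition_bound {n : ℕ} {A : ℝ → Matrix (Fin n) (Fin n) ℝ} {T : ℝ}
    (hT : 0 < T) (hA : PiecewiseContinuousOn A univ) (hper : Function.Periodic A T)
    (hexp : ∀ μ : ℂ, IsCharacteristicExponent A T μ → μ.re ≤ 0) :
    ∃ Φ Ψ : ℝ → Matrix (Fin n) (Fin n) ℝ,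
      IsFundamentalPair A {t | ¬ ContinuousAt A t} Φ Ψ ∧
      ∀ ε > 0, ∃ C > 0, ∀ s t, 0 ≤ s → s ≤ t → ‖Φ t * Ψ s‖ ≤ C * Real.exp (ε * (t - s)) := by
  have hD : {t | ¬ ContinuousAt A t}.Countable := by
    have := hA.countable_discontinuities
    simpa only [mem_univ, true_and, continuousWithinAt_univ] using this
  have : CompleteSpace (Matrix (Fin n) (Fin n) ℝ) := FiniteDimensional.complete ℝ _
  have : CompleteSpace (Matrix (Fin n) (Fin n) ℂ) := FiniteDimensional.complete ℂ _
  obtain ⟨M, hM⟩ := PiecewiseContinuousOn.exists_norm_le_of_periodic hA hT hper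
  obtain ⟨Φ, Ψ, h⟩ := exists_isFundamentalPair (A := A) (D := {t | ¬ ContinuousAt A t}) hD
    (fun t ht => not_not.1 ht) hM
  refine ⟨Φ, Ψ, h, fun ε hε => h.exists_norm_transition_le hD hT hper (fun r hr => ?_) hε⟩
  obtain ⟨C, hC⟩ := exists_norm_pow_le_of_spectralRadius_le_one
    (fun z hz => h.norm_le_one_of_mem_spectrum hD hT hper hexp hz) hr
  refine ⟨C, fun k => ?_⟩
  rw [← Matrix.linfty_opNorm_map_ofReal, Matrix.map_ofReal_pow]
  exact hC k

/-! ### Scalar consensus: invariance of the range and growth estimates -/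

theorem hasDerivAt_min_zero_sq (x : ℝ) :
    HasDerivAt (fun y : ℝ => min y 0 ^ 2) (2 * min x 0) x := by
  rcases lt_trichotomy x 0 with h | rfl | h
  · rw [min_eq_left h.le]
    have h1 : HasDerivAt (fun y : ℝ => y ^ 2) (2 * x) x := by simpa using hasDerivAt_pow 2 x
    refine h1.congr_of_eventuallyEq ?_
    filter_upwards [Iio_mem_nhds h] with y hy
    rw [min_eq_left (le_of_lt hy)]
  · rw [hasDerivAt_iff_isLittleO_nhds_zero]
    simp only [zero_add, min_self, mul_zero, smul_zero, sub_zero, ne_eq, OfNat.ofNat_ne_zero,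
      not_false_eq_true, zero_pow]
    refine Asymptotics.IsBigO.trans_isLittleO (g := fun h : ℝ => h ^ 2) ?_
      (Asymptotics.isLittleO_pow_id (by norm_num))
    refine Asymptotics.IsBigO.of_bound 1 (Eventually.of_forall fun y => ?_)
    rw [one_mul, norm_pow, norm_pow]
    gcongr
    rcases le_total y 0 with hy | hy
    · rw [min_eq_left hy]
    · rw [min_eq_right hy]; simp
  · rw [min_eq_right h.le, mul_zero]
    refine (hasDerivAt_const x (0 : ℝ)).congr_of_eventuallyEq ?_
    filter_upwards [Ioi_mem_nhds h] with y hy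
    rw [min_eq_right (le_of_lt hy)]; norm_num

/-- Time-varying weights in `[0, γ]` on `[0, ∞)` that are continuous off the countable set `D`. -/
structure IsWeightOff {N : ℕ} (a : ℝ → Matrix (Fin N) (Fin N) ℝ) (γ : ℝ) (D : Set ℝ) : Prop where
  countable : D.Countable
  nonneg : ∀ t, 0 ≤ t → ∀ k j, 0 ≤ a t k j
  le : ∀ t, 0 ≤ t → ∀ k j, a t k j ≤ γ
  continuousAt : ∀ t, 0 < t → t ∉ D → ∀ k j, ContinuousAt (fun τ => a τ k j) t

/-- `w` solves the scalar consensus system `w_k' = ∑ j, a_kj (w_j - w_k)` on `[t₀, ∞)` off `D`. -/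
structure IsConsensusSolution {N : ℕ} (a : ℝ → Matrix (Fin N) (Fin N) ℝ) (D : Set ℝ) (t₀ : ℝ)
    (w : ℝ → Fin N → ℝ) : Prop where
  continuousOn : ∀ k, ContinuousOn (fun t => w t k) (Ici t₀)
  hasDerivAt : ∀ t, t₀ < t → t ∉ D → ∀ k,
    HasDerivAt (fun τ => w τ k) (∑ j, a t k j * (w t j - w t k)) t

namespace IsConsensusSolution
variable {N : ℕ} {a : ℝ → Matrix (Fin N) (Fin N) ℝ} {γ : ℝ} {D : Set ℝ} {t₀ : ℝ}
  {w : ℝ → Fin N → ℝ}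

theorem mono (h : IsConsensusSolution a D t₀ w) {s : ℝ} (hs : t₀ ≤ s) :
    IsConsensusSolution a D s w :=
  ⟨fun k => (h.continuousOn k).mono (Ici_subset_Ici.2 hs),
    fun t ht => h.hasDerivAt t (hs.trans_lt ht)⟩

theorem sub_const (h : IsConsensusSolution a D t₀ w) (m : ℝ) :
    IsConsensusSolution a D t₀ (fun t k => w t k - m) :=
  ⟨fun k => (h.continuousOn k).sub continuousOn_const,
    fun t ht htD k => by simpa using (h.hasDerivAt t ht htD k).sub_const m⟩

theorem const_sub (h : IsConsensusSolution a D t₀ w) (m : ℝ) :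
    IsConsensusSolution a D t₀ (fun t k => m - w t k) :=
  ⟨fun k => continuousOn_const.sub (h.continuousOn k), fun t ht htD k => by
    have e : ∑ j, a t k j * ((m - w t j) - (m - w t k)) = -∑ j, a t k j * (w t j - w t k) := by
      rw [← Finset.sum_neg_distrib]; exact Finset.sum_congr rfl fun j _ => by ring
    rw [e]; exact (h.hasDerivAt t ht htD k).const_sub m⟩

/-- The smooth penalty ∑ min(w_k, 0)² starts at zero and grows at most at rate γN, so its product
with exp(-γNt) cannot increase and the penalty stays zero. -/
theorem nonneg (h : IsConsensusSolution a D t₀ w) (ha : IsWeightOff a γ D) (ht₀ : 0 ≤ t₀)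
    (h0 : ∀ k, 0 ≤ w t₀ k) {t : ℝ} (ht : t₀ ≤ t) (k : Fin N) : 0 ≤ w t k := by
  have hmono := image_le_of_hasDerivAt_nonpos_off_countable
    (g := fun t => Real.exp (-(γ * N) * t) * ∑ k, min (w t k) 0 ^ 2)
    (g' := fun t => Real.exp (-(γ * N) * t) * (-(γ * N) * 1) * (∑ k, min (w t k) 0 ^ 2) +
      Real.exp (-(γ * N) * t) *
        ∑ k, 2 * min (w t k) 0 * ∑ j, a t k j * (w t j - w t k)) ha.countable ht
    (by
      refine ContinuousOn.mul (by fun_prop) (continuousOn_finsetSum _ fun k _ => ?_)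
      exact (((h.continuousOn k).mono Icc_subset_Ici_self).inf continuousOn_const).pow 2)
    (fun s hs => by
      refine (((hasDerivAt_id s).const_mul _).exp).mul (HasDerivAt.fun_sum fun k _ => ?_)
      exact (hasDerivAt_min_zero_sq (w s k)).comp s (h.hasDerivAt s hs.1.1 hs.2 k))
    (fun s hs => by
      have hs0 : 0 ≤ s := ht₀.trans hs.1.1.le
      have hk : ∀ k, 2 * min (w s k) 0 * ∑ j, a s k j * (w s j - w s k) ≤
          γ * ∑ j, min (w s j) 0 ^ 2 := fun k => by
        rw [Finset.mul_sum, Finset.mul_sum]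
        refine Finset.sum_le_sum fun j _ => ?_
        have hm : min (w s k) 0 ≤ 0 := min_le_right _ _
        have hj : min (w s j) 0 ≤ w s j := min_le_left _ _
        have hkk : min (w s k) 0 * w s k = min (w s k) 0 ^ 2 := by
          rcases le_total (w s k) 0 with h | h
          · rw [min_eq_left h]; ring
          · rw [min_eq_right h]; ring
        have h1 := mul_nonneg (neg_nonneg.2 hm) (sub_nonneg.2 hj)
        -- With m = min(w, 0), the left side is at most 2 m_k m_j - 2 m_k² ≤ m_j² - m_k².
        have h2 : 2 * min (w s k) 0 * (w s j - w s k) ≤ min (w s j) 0 ^ 2 := by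
          nlinarith [sq_nonneg (min (w s k) 0 - min (w s j) 0), sq_nonneg (min (w s k) 0)]
        calc _ = a s k j * (2 * min (w s k) 0 * (w s j - w s k)) := by ring
          _ ≤ a s k j * min (w s j) 0 ^ 2 := mul_le_mul_of_nonneg_left h2 (ha.nonneg s hs0 k j)
          _ ≤ _ := mul_le_mul_of_nonneg_right (ha.le s hs0 k j) (sq_nonneg _)
      have hsum : ∑ k, 2 * min (w s k) 0 * ∑ j, a s k j * (w s j - w s k) ≤
          N * (γ * ∑ j, min (w s j) 0 ^ 2) :=
        (Finset.sum_le_sum fun k _ => hk k).trans (by simp)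
      have := mul_le_mul_of_nonneg_left hsum (Real.exp_pos (-(γ * N) * s)).le
      nlinarith)
  have h00 : ∑ k, min (w t₀ k) 0 ^ 2 = 0 :=
    Finset.sum_eq_zero fun k _ => by rw [min_eq_right (h0 k)]; norm_num
  simp only [h00, mul_zero] at hmono
  have hle := nonpos_of_mul_nonpos_right hmono (Real.exp_pos _)
  have hk := (Finset.single_le_sum (f := fun k => min (w t k) 0 ^ 2) (fun _ _ => sq_nonneg _)
    (Finset.mem_univ k)).trans hle
  have : min (w t k) 0 = 0 := by
    have := le_antisymm hk (sq_nonneg _)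
    exact pow_eq_zero_iff (two_ne_zero) |>.1 this
  rw [← this]; exact min_le_left _ _

theorem le_of_le (h : IsConsensusSolution a D t₀ w) (ha : IsWeightOff a γ D) (ht₀ : 0 ≤ t₀)
    {m : ℝ} (h0 : ∀ k, m ≤ w t₀ k) {t : ℝ} (ht : t₀ ≤ t) (k : Fin N) : m ≤ w t k :=
  sub_nonneg.1 ((h.sub_const m).nonneg ha ht₀ (fun k => sub_nonneg.2 (h0 k)) ht k)

theorem ge_of_ge (h : IsConsensusSolution a D t₀ w) (ha : IsWeightOff a γ D) (ht₀ : 0 ≤ t₀)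
    {m : ℝ} (h0 : ∀ k, w t₀ k ≤ m) {t : ℝ} (ht : t₀ ≤ t) (k : Fin N) : w t k ≤ m :=
  sub_nonneg.1 ((h.const_sub m).nonneg ha ht₀ (fun k => sub_nonneg.2 (h0 k)) ht k)

/-- For nonnegative consensus states, a node's derivative is bounded below by its own decay and the
inflow from any single neighbour. -/
theorem inflow_le (ha : IsWeightOff a γ D) {t : ℝ} (ht : 0 ≤ t) {v : Fin N → ℝ}
    (hv : ∀ k, 0 ≤ v k) (k l : Fin N) :
    a t k l * v l ≤ γ * N * v k + ∑ j, a t k j * (v j - v k) := by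
  have h1 : ∑ j, a t k j * (v j - v k) = ∑ j, a t k j * v j - ∑ j, a t k j * v k := by
    rw [← Finset.sum_sub_distrib]; exact Finset.sum_congr rfl fun j _ => by ring
  have h2 : ∑ j, a t k j * v k ≤ γ * N * v k :=
    (Finset.sum_le_sum fun j _ => mul_le_mul_of_nonneg_right (ha.le t ht k j) (hv k)).trans
      (by simp; linarith)
  have h3 : a t k l * v l ≤ ∑ j, a t k j * v j :=
    Finset.single_le_sum (f := fun j => a t k j * v j)
      (fun j _ => mul_nonneg (ha.nonneg t ht k j) (hv j)) (Finset.mem_univ l)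
  linarith

/-- A node that listens to `l` across `[t₀, t₀ + S]` ends up bounded below if `l` is. -/
theorem exp_mul_add_le (h : IsConsensusSolution a D t₀ w) (ha : IsWeightOff a γ D)
    (ht₀ : 0 ≤ t₀) (h0 : ∀ k, 0 ≤ w t₀ k) {t : ℝ} (ht : t₀ ≤ t) {κ : ℝ} (k l : Fin N)
    (hl : ∀ s ∈ Icc t₀ t, κ ≤ w s l) :
    Real.exp (-(γ * N) * (t - t₀)) * (w t₀ k + κ * ∫ τ in t₀..t, a τ k l) ≤ w t k := by
  have hγ : 0 ≤ γ := (ha.nonneg t₀ ht₀ k k).trans (ha.le t₀ ht₀ k k)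
  have hint : ∀ s, t₀ ≤ s → IntervalIntegrable (fun τ => a τ k l) volume t₀ s := fun s hs => by
    refine intervalIntegrable_of_continuousAt_off_countable (C := γ) ha.countable ?_ ?_ <;>
      rw [uIoc_of_le hs]
    · exact fun τ hτ => ha.continuousAt τ (ht₀.trans_lt hτ.1.1) hτ.2 k l
    · intro τ hτ
      have hτ0 := ht₀.trans hτ.1.le
      rw [Real.norm_of_nonneg (ha.nonneg τ hτ0 k l)]
      exact ha.le τ hτ0 k l
  -- The integrating factor cancels the node's own decay and leaves the inflow, at least a_kl w_l ≥
  -- κ a_kl. Being at least 1, the factor can be dropped from the nonnegative inflow.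
  have hmono := le_image_of_hasDerivAt_nonneg_off_countable
    (g := fun s => Real.exp (γ * N * (s - t₀)) * w s k - κ * ∫ τ in t₀..s, a τ k l)
    (g' := fun s => Real.exp (γ * N * (s - t₀)) * (γ * N * 1) * w s k +
      Real.exp (γ * N * (s - t₀)) * (∑ j, a s k j * (w s j - w s k)) - κ * a s k l)
    ha.countable ht
    (by
      refine ContinuousOn.sub (ContinuousOn.mul (by fun_prop)
        ((h.continuousOn k).mono Icc_subset_Ici_self)) (continuousOn_const.mul ?_)
      have := intervalIntegral.continuousOn_primitive_interval' (hint t ht) left_mem_uIcc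
      rwa [uIcc_of_le ht] at this)
    (fun s hs => by
      refine ((((hasDerivAt_id s).sub_const t₀).const_mul _).exp.mul
        (h.hasDerivAt s hs.1.1 hs.2 k)).sub (HasDerivAt.const_mul _ ?_)
      refine intervalIntegral.integral_hasDerivAt_right (hint s hs.1.1.le) ?_
        (ha.continuousAt s (ht₀.trans_lt hs.1.1) hs.2 k l)
      exact ⟨Ioi t₀, Ioi_mem_nhds hs.1.1,
        aestronglyMeasurable_of_continuousAt_off_countable measurableSet_Ioi ha.countable
          fun τ hτ => ha.continuousAt τ (ht₀.trans_lt hτ.1) hτ.2 k l⟩)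
    (fun s hs => by
      have hs0 : 0 ≤ s := ht₀.trans hs.1.1.le
      have hnn := fun j => h.nonneg ha ht₀ h0 hs.1.1.le j
      have h1 := inflow_le ha hs0 hnn k l
      have h2 : 1 ≤ Real.exp (γ * N * (s - t₀)) :=
        Real.one_le_exp (mul_nonneg (by positivity) (by linarith [hs.1.1]))
      have h3 := mul_le_mul_of_nonneg_left (hl s ⟨hs.1.1.le, hs.1.2.le⟩) (ha.nonneg s hs0 k l)
      have h4 := mul_nonneg (ha.nonneg s hs0 k l) (hnn l)
      have h5 := mul_le_mul_of_nonneg_left h1 (zero_le_one.trans h2)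
      have h6 := mul_le_mul_of_nonneg_right h2 h4
      linarith)
  simp only [sub_self, mul_zero, Real.exp_zero, one_mul, intervalIntegral.integral_same,
    sub_zero] at hmono
  have h7 := mul_le_mul_of_nonneg_left (le_sub_iff_add_le.1 hmono)
    (Real.exp_pos (-(γ * N) * (t - t₀))).le
  rwa [← mul_assoc, ← Real.exp_add, ← add_mul, neg_add_cancel, zero_mul, Real.exp_zero,
    one_mul] at h7

theorem exp_mul_le (h : IsConsensusSolution a D t₀ w) (ha : IsWeightOff a γ D)
    (ht₀ : 0 ≤ t₀) (h0 : ∀ k, 0 ≤ w t₀ k) {t : ℝ} (ht : t₀ ≤ t) (k : Fin N) :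
    Real.exp (-(γ * N) * (t - t₀)) * w t₀ k ≤ w t k := by
  have := h.exp_mul_add_le ha ht₀ h0 ht (κ := 0) k k
    fun s hs => h.nonneg ha ht₀ h0 hs.1 k
  simpa using this

end IsConsensusSolution

/-! ### Contraction of the range through connectedness -/

theorem Relation.TransGen.exists_crossing {α : Type*} {r : α → α → Prop} {P : Set α} {x y : α}
    (h : Relation.TransGen r x y) (hx : x ∉ P) (hy : y ∈ P) : ∃ u ∉ P, ∃ v ∈ P, r u v := by
  induction h with
  | single h => exact ⟨x, hx, _, hy, h⟩
  | tail _ h ih =>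
    rename_i b c _
    by_cases hb : b ∈ P
    · exact ih hb
    · exact ⟨b, hb, c, hy, h⟩

namespace IsConsensusSolution
variable {N : ℕ} {a : ℝ → Matrix (Fin N) (Fin N) ℝ} {γ : ℝ} {D : Set ℝ} {t₀ : ℝ}
  {w : ℝ → Fin N → ℝ}

/-- The set of nodes bounded below grows by one in each window until it contains all nodes. -/
theorem exists_finset_lower_bound (h : IsConsensusSolution a D t₀ w) (ha : IsWeightOff a γ D)
    (ht₀ : 0 ≤ t₀) (h0 : ∀ k, 0 ≤ w t₀ k) {S δ : ℝ} (hS : 0 < S) {k₀ : Fin N}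
    (hconn : ∀ t, 0 ≤ t → ∀ j, j ≠ k₀ → Relation.TransGen (EdgeAcross a δ S t) j k₀)
    {ρ κ : ℝ} (hρ : 0 ≤ ρ) (hρ1 : ρ ≤ Real.exp (-(γ * N) * S))
    (hρδ : ρ ≤ Real.exp (-(γ * N) * S) ^ 2 * δ) (hκ : 0 ≤ κ) (hk : κ ≤ w t₀ k₀) (i : ℕ) :
    ∃ P : Finset (Fin N), k₀ ∈ P ∧ (i < P.card ∨ P = Finset.univ) ∧
      ∀ j ∈ P, ρ ^ i * κ ≤ w (t₀ + i * S) j := by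
  induction i with
  | zero => exact ⟨{k₀}, by simp, by simp, by simpa using hk⟩
  | succ i ih =>
    obtain ⟨P, hkP, hP, hPw⟩ := ih
    have hiS : 0 ≤ i * S := by positivity
    set s := t₀ + i * S with hs
    have hs0 : 0 ≤ s := by linarith
    have hnext : t₀ + (i + 1 : ℕ) * S = s + S := by rw [hs]; push_cast; ring
    have hsol := h.mono (s := s) (by linarith)
    have hsnn : ∀ k, 0 ≤ w s k := fun k => h.nonneg ha ht₀ h0 (by linarith) k
    have hpk : 0 ≤ ρ ^ i * κ := by positivity
    have hγ : 0 ≤ γ := (ha.nonneg t₀ ht₀ k₀ k₀).trans (ha.le t₀ ht₀ k₀ k₀)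
    have hdecay : ∀ j ∈ P, ∀ t ∈ Icc s (s + S),
        Real.exp (-(γ * N) * S) * (ρ ^ i * κ) ≤ w t j := fun j hj t ht => by
      refine le_trans ?_ (hsol.exp_mul_le ha hs0 hsnn ht.1 j)
      refine mul_le_mul (Real.exp_le_exp.2 ?_) (hPw j hj) hpk (Real.exp_pos _).le
      rw [neg_mul, neg_mul, neg_le_neg_iff]
      exact mul_le_mul_of_nonneg_left (by linarith [ht.2]) (by positivity)
    have hold : ∀ j ∈ P, ρ ^ (i + 1) * κ ≤ w (s + S) j := fun j hj => by
      refine le_trans ?_ (hdecay j hj (s + S) ⟨by linarith, le_rfl⟩)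
      rw [pow_succ', mul_assoc]
      exact mul_le_mul_of_nonneg_right hρ1 hpk
    rw [hnext]
    by_cases huniv : P = Finset.univ
    · exact ⟨P, hkP, Or.inr huniv, hold⟩
    obtain ⟨j₀, hj₀⟩ : ∃ j, j ∉ P := by
      by_contra! hh; exact huniv (Finset.eq_univ_iff_forall.2 hh)
    -- On a path to the root some edge enters P: its tail u listens to v ∈ P during this window and
    -- joins P. One factor exp(-γNS) pays for the decay of v, a second for that of u, whence the
    -- bound on ρ.
    obtain ⟨u, hu, v, hv, huv⟩ := (hconn s hs0 j₀ fun he => hj₀ (he ▸ hkP)).exists_crossing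
      (P := (P : Set (Fin N))) (by simpa using hj₀) (by simpa using hkP)
    simp only [Finset.mem_coe] at hu hv
    refine ⟨insert u P, Finset.mem_insert_of_mem hkP, Or.inl ?_, fun j hj => ?_⟩
    · rw [Finset.card_insert_of_notMem hu]
      have := hP.resolve_right huniv
      omega
    · rcases Finset.mem_insert.1 hj with rfl | hj
      · have h1 := hsol.exp_mul_add_le ha hs0 hsnn (by linarith : s ≤ s + S) j v (hdecay v hv)
        refine le_trans ?_ h1
        rw [add_sub_cancel_left, pow_succ', mul_assoc]
        have h2 : Real.exp (-(γ * N) * S) * (ρ ^ i * κ) * δ ≤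
            Real.exp (-(γ * N) * S) * (ρ ^ i * κ) * ∫ τ in s..(s + S), a τ j v :=
          mul_le_mul_of_nonneg_left huv (by positivity)
        calc ρ * (ρ ^ i * κ) ≤ Real.exp (-(γ * N) * S) ^ 2 * δ * (ρ ^ i * κ) :=
              mul_le_mul_of_nonneg_right hρδ hpk
          _ = Real.exp (-(γ * N) * S) * (Real.exp (-(γ * N) * S) * (ρ ^ i * κ) * δ) := by ring
          _ ≤ _ := mul_le_mul_of_nonneg_left (by linarith [hsnn j]) (Real.exp_pos _).le
      · exact hold j hj

theorem forall_lower_bound (h : IsConsensusSolution a D t₀ w) (ha : IsWeightOff a γ D)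
    (ht₀ : 0 ≤ t₀) (h0 : ∀ k, 0 ≤ w t₀ k) {S δ : ℝ} (hS : 0 < S) {k₀ : Fin N}
    (hconn : ∀ t, 0 ≤ t → ∀ j, j ≠ k₀ → Relation.TransGen (EdgeAcross a δ S t) j k₀)
    {ρ κ : ℝ} (hρ : 0 ≤ ρ) (hρ1 : ρ ≤ Real.exp (-(γ * N) * S))
    (hρδ : ρ ≤ Real.exp (-(γ * N) * S) ^ 2 * δ) (hκ : 0 ≤ κ) (hk : κ ≤ w t₀ k₀) (j : Fin N) :
    ρ ^ N * κ ≤ w (t₀ + N * S) j := by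
  obtain ⟨P, -, hP, hPw⟩ := h.exists_finset_lower_bound ha ht₀ h0 hS hconn hρ hρ1 hρδ hκ hk N
  have hu : P = Finset.univ := hP.resolve_left (by
    have := P.card_le_univ; rw [Fintype.card_fin] at this; omega)
  exact hPw j (hu ▸ Finset.mem_univ j)

theorem sub_le_of_sub_le (h : IsConsensusSolution a D t₀ w) (ha : IsWeightOff a γ D)
    (ht₀ : 0 ≤ t₀) {R : ℝ} (hR : ∀ k j, w t₀ k - w t₀ j ≤ R) {t : ℝ} (ht : t₀ ≤ t)
    (k j : Fin N) : w t k - w t j ≤ R := by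
  have : Nonempty (Fin N) := ⟨k⟩
  obtain ⟨p, hp⟩ := Finite.exists_min (w t₀)
  obtain ⟨q, hq⟩ := Finite.exists_max (w t₀)
  linarith [h.le_of_le ha ht₀ hp ht j, h.ge_of_ge ha ht₀ hq ht k, hR q p]

theorem sub_le_contraction (h : IsConsensusSolution a D t₀ w) (ha : IsWeightOff a γ D)
    (ht₀ : 0 ≤ t₀) {S δ : ℝ} (hS : 0 < S) {k₀ : Fin N}
    (hconn : ∀ t, 0 ≤ t → ∀ j, j ≠ k₀ → Relation.TransGen (EdgeAcross a δ S t) j k₀)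
    {ρ : ℝ} (hρ : 0 ≤ ρ) (hρ1 : ρ ≤ Real.exp (-(γ * N) * S))
    (hρδ : ρ ≤ Real.exp (-(γ * N) * S) ^ 2 * δ) (hρ2 : ρ ^ N ≤ 1)
    {R : ℝ} (hR : ∀ k j, w t₀ k - w t₀ j ≤ R) (k j : Fin N) :
    w (t₀ + N * S) k - w (t₀ + N * S) j ≤ (1 - ρ ^ N / 2) * R := by
  have : Nonempty (Fin N) := ⟨k⟩
  obtain ⟨p, hp⟩ := Finite.exists_min (w t₀)
  obtain ⟨q, hq⟩ := Finite.exists_max (w t₀)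
  have hL : t₀ ≤ t₀ + N * S := by nlinarith [Nat.cast_nonneg (α := ℝ) N]
  have hmM : 0 ≤ (w t₀ q - w t₀ p) / 2 := by linarith [hp q]
  have hlo := h.le_of_le ha ht₀ hp hL
  have hhi := h.ge_of_ge ha ht₀ hq hL
  have hend : (1 - ρ ^ N / 2) * (w t₀ q - w t₀ p) ≤ (1 - ρ ^ N / 2) * R :=
    mul_le_mul_of_nonneg_left (hR q p) (by linarith)
  -- If the root is in the upper half of the range, the minimum rises by ρ ^ N times half the range;
  -- otherwise the reflected solution shows that the maximum falls by as much.
  rcases le_total ((w t₀ q - w t₀ p) / 2) (w t₀ k₀ - w t₀ p) with hk | hk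
  · have := (h.sub_const (w t₀ p)).forall_lower_bound ha ht₀ (fun k => sub_nonneg.2 (hp k)) hS
      hconn hρ hρ1 hρδ hmM hk j
    linarith [hhi k]
  · have := (h.const_sub (w t₀ q)).forall_lower_bound ha ht₀ (fun k => sub_nonneg.2 (hq k)) hS
      hconn hρ hρ1 hρδ hmM (by linarith) k
    linarith [hlo j]

/-- The common limit is squeezed between the minimum and the maximum of the states. -/
theorem exists_forall_abs_sub_le (h : IsConsensusSolution a D t₀ w) (ha : IsWeightOff a γ D)
    (ht₀ : 0 ≤ t₀) [Nonempty (Fin N)] :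
    ∃ β, ∀ t, t₀ ≤ t → ∀ R, (∀ k j, w t k - w t j ≤ R) → ∀ k, |w t k - β| ≤ R := by
  have hlow : ∀ s, t₀ ≤ s → ∀ t, t₀ ≤ t → ∀ m, (∀ k, w t k ≤ m) → ∀ p, (∀ k, w s p ≤ w s k) →
      w s p ≤ m := fun s hs t ht m hm p hp => by
    have h1 := (h.mono hs).le_of_le ha (ht₀.trans hs) hp (le_max_left s t) p
    have h2 := (h.mono ht).ge_of_ge ha (ht₀.trans ht) hm (le_max_right s t) p
    exact h1.trans h2
  -- Every minimum is at most every maximum, whatever their times, as `hlow` shows by comparing at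
  -- the later time. The supremum of the minima hence lies in the range at all times.
  set V : Set ℝ := {x | ∃ s, t₀ ≤ s ∧ ∃ p, (∀ k, w s p ≤ w s k) ∧ x = w s p} with hV
  refine ⟨sSup V, fun t ht R hR k => ?_⟩
  obtain ⟨p, hp⟩ := Finite.exists_min (w t)
  obtain ⟨q, hq⟩ := Finite.exists_max (w t)
  have hub : ∀ x ∈ V, x ≤ w t q := by
    rintro x ⟨s, hs, p', hp', rfl⟩
    exact hlow s hs t ht _ hq p' hp'
  have hpV : w t p ∈ V := ⟨t, ht, p, hp, rfl⟩
  have h1 : w t p ≤ sSup V := le_csSup ⟨_, hub⟩ hpV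
  have h2 : sSup V ≤ w t q := csSup_le ⟨_, hpV⟩ hub
  rw [abs_le]
  constructor <;> linarith [hR q p, hp k, hq k]

end IsConsensusSolution

/-- Uniformly connected consensus systems converge exponentially, uniformly in the initial time. -/
theorem UniformlyConnected.exists_exponential_consensus {N : ℕ}
    {a : ℝ → Matrix (Fin N) (Fin N) ℝ} {γ : ℝ} {D : Set ℝ} (hconn : UniformlyConnected a)
    (ha : IsWeightOff a γ D) :
    ∃ c > 0, ∃ d > 0, ∀ t₀, 0 ≤ t₀ → ∀ w : ℝ → Fin N → ℝ, IsConsensusSolution a D t₀ w →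
      ∃ β, ∀ R, (∀ k j, w t₀ k - w t₀ j ≤ R) →
        ∀ t, t₀ ≤ t → ∀ k, |w t k - β| ≤ c * Real.exp (-d * (t - t₀)) * R := by
  obtain ⟨S, hS, δ, hδ, k₀, hconn⟩ := hconn
  have : Nonempty (Fin N) := ⟨k₀⟩
  have hN : (0 : ℝ) < N := by exact_mod_cast k₀.pos
  have hγ : 0 ≤ γ := (ha.nonneg 0 le_rfl k₀ k₀).trans (ha.le 0 le_rfl k₀ k₀)
  set e := Real.exp (-(γ * N) * S) with he
  have he0 : 0 < e := Real.exp_pos _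
  have he1 : e ≤ 1 := Real.exp_le_one_iff.2 (by
    rw [neg_mul]; exact neg_nonpos.2 (by positivity))
  set ρ := min e (e ^ 2 * δ) with hρdef
  have hρ : 0 < ρ := lt_min he0 (by positivity)
  have hρ1 : ρ ≤ 1 := (min_le_left _ _).trans he1
  have hρN : ρ ^ N ≤ 1 := pow_le_one₀ hρ.le hρ1
  set q := 1 - ρ ^ N / 2 with hq
  have hρN0 : 0 < ρ ^ N := pow_pos hρ N
  have hq0 : 0 < q := by linarith
  have hq1 : q < 1 := by linarith
  set L := N * S with hLdef
  have hL : 0 < L := by positivity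
  have hlog : 0 < -Real.log q := neg_pos.2 (Real.log_neg hq0 hq1)
  -- Each period L contributes a factor q; the constant 1/q pays for the incomplete last period.
  refine ⟨Real.exp (-Real.log q), Real.exp_pos _, -Real.log q / L, div_pos hlog hL,
    fun t₀ ht₀ w hw => ?_⟩
  obtain ⟨β, hβ⟩ := hw.exists_forall_abs_sub_le ha ht₀
  refine ⟨β, fun R hR t ht k => hβ t ht _ (fun k j => ?_) k⟩
  have hR0 : 0 ≤ R := by have := hR k₀ k₀; rwa [sub_self] at this
  have hiter : ∀ i : ℕ, ∀ k j, w (t₀ + i * L) k - w (t₀ + i * L) j ≤ q ^ i * R := by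
    intro i
    induction i with
    | zero => simpa using hR
    | succ i ih =>
      have hiL : 0 ≤ i * L := by positivity
      have hstep := (hw.mono (s := t₀ + i * L) (by linarith)).sub_le_contraction ha
        (by linarith) hS hconn hρ.le (min_le_left _ _) (min_le_right _ _) hρN ih
      intro k j
      have e1 : t₀ + (i + 1 : ℕ) * L = t₀ + i * L + N * S := by rw [hLdef]; push_cast; ring
      rw [e1, pow_succ', mul_assoc]
      exact hstep k j
  set i := ⌊(t - t₀) / L⌋₊
  have hi1 := (le_div_iff₀ hL).1 (Nat.floor_le (div_nonneg (sub_nonneg.2 ht) hL.le))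
  have hi2 := (Nat.lt_floor_add_one ((t - t₀) / L)).le
  have hiL : 0 ≤ i * L := by positivity
  refine ((hw.mono (s := t₀ + i * L) (by linarith)).sub_le_of_sub_le ha (by linarith) (hiter i)
    (by linarith) k j).trans (mul_le_mul_of_nonneg_right ?_ hR0)
  rw [← Real.exp_log (pow_pos hq0 i), Real.log_pow, ← Real.exp_add, Real.exp_le_exp]
  have : -(-Real.log q / L) * (t - t₀) = Real.log q * ((t - t₀) / L) := by ring
  rw [this]
  nlinarith

/-! ### From the closed loop to scalar consensus, and synchronization -/

theorem IsSolutionOn.hasDerivAt {E : Type*} [NormedAddCommGroup E] [NormedSpace ℝ E]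
    [CompleteSpace E] {f : ℝ → E → E} {t₀ : ℝ} {x : ℝ → E} (hx : IsSolutionOn f (Ici t₀) x)
    {t : ℝ} (ht : t₀ < t) (hf : ContinuousAt (fun τ => f τ (x τ)) t) :
    HasDerivAt x (f t (x t)) t := by
  have hm : t₀ ∈ Ici t₀ := self_mem_Ici
  have hmeas : StronglyMeasurableAtFilter (fun τ => f τ (x τ)) (𝓝 t) volume :=
    ⟨Ioc t₀ (t + 1), Ioc_mem_nhds ht (lt_add_one t),
      (hx.2 t₀ hm (t + 1) (by simp only [mem_Ici]; linarith)).1.1.aestronglyMeasurable⟩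
  refine ((intervalIntegral.integral_hasDerivAt_right (hx.2 t₀ hm t ht.le).1 hmeas hf).const_add
    (x t₀)).congr_of_eventuallyEq ?_
  filter_upwards [Ioi_mem_nhds ht] with s hs
  exact (hx.2 t₀ hm s (Ioi_subset_Ici_self hs)).2

theorem abs_le_stackNorm {N n : ℕ} (x : Fin N → Fin n → ℝ) (k : Fin N) (i : Fin n) :
    |x k i| ≤ stackNorm x := by
  refine Real.abs_le_sqrt ?_
  exact (Finset.single_le_sum (f := fun i => x k i ^ 2) (fun _ _ => sq_nonneg _)
    (Finset.mem_univ i)).trans (Finset.single_le_sum (f := fun k => ∑ i, x k i ^ 2)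
      (fun _ _ => Finset.sum_nonneg fun _ _ => sq_nonneg _) (Finset.mem_univ k))

theorem stackNorm_le {N n : ℕ} {x : Fin N → Fin n → ℝ} {R : ℝ} (hR : 0 ≤ R)
    (h : ∀ k, ‖x k‖ ≤ R) : stackNorm x ≤ Real.sqrt (N * n) * R := by
  rw [stackNorm, ← Real.sqrt_sq hR, ← Real.sqrt_mul (by positivity)]
  refine Real.sqrt_le_sqrt ?_
  have : ∀ k i, x k i ^ 2 ≤ R ^ 2 := fun k i =>
    sq_le_sq' (by linarith [neg_abs_le (x k i), (norm_le_pi_norm (x k) i).trans (h k),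
      Real.norm_eq_abs (x k i)]) ((le_abs_self _).trans ((norm_le_pi_norm (x k) i).trans (h k)))
  calc ∑ k, ∑ i, x k i ^ 2 ≤ ∑ _k : Fin N, ∑ _i : Fin n, R ^ 2 :=
        Finset.sum_le_sum fun k _ => Finset.sum_le_sum fun i _ => this k i
    _ = N * n * R ^ 2 := by simp [mul_assoc]

theorem IsAdjacency.isWeightOff {N : ℕ} {a : ℝ → Matrix (Fin N) (Fin N) ℝ} {η γ : ℝ}
    (ha : IsAdjacency a η γ) {D : Set ℝ} (hD : D.Countable)
    (hL : ∀ t, 0 < t → t ∉ D → ContinuousAt (fun τ => graphLaplacian (a τ)) t) :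
    IsWeightOff a γ D := by
  refine ⟨hD, fun t ht k j => ?_, fun t ht k j => ?_, fun t ht htD k j => ?_⟩
  · rcases ha.weight t ht k j with h | h
    · exact h.ge
    · exact ha.pos.le.trans h.1
  · rcases ha.weight t ht k j with h | h
    · exact h ▸ ha.pos.le.trans ha.le
    · exact h.2
  · by_cases hjk : j = k
    · subst hjk
      refine (continuousAt_const (y := (0 : ℝ))).congr ?_
      filter_upwards [Ioi_mem_nhds ht] with s hs
      exact (ha.diag s (le_of_lt hs) j).symm
    · have h1 : ContinuousAt (fun τ => -graphLaplacian (a τ) k j) t :=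
        (continuousAt_pi.1 (continuousAt_pi.1 (hL t ht htD) k) j).neg
      simpa [graphLaplacian, hjk] using h1

theorem closedLoop_apply {N n : ℕ} {A : ℝ → Matrix (Fin n) (Fin n) ℝ}
    {B : Matrix (Fin n) (Fin n) ℝ} (hB : IsUnit B.det) (a : ℝ → Matrix (Fin N) (Fin N) ℝ) (t : ℝ)
    (x : Fin N → Fin n → ℝ) (k : Fin N) :
    closedLoop A B a t x k = A t *ᵥ x k + ∑ j, a t k j • (x j - x k) := by
  rw [closedLoop, syncControl, Matrix.mulVec_mulVec, Matrix.mul_nonsing_inv B hB,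
    Matrix.one_mulVec]

theorem IsWeightOff.hasDerivAt_closedLoop {N n : ℕ} {A : ℝ → Matrix (Fin n) (Fin n) ℝ}
    {B : Matrix (Fin n) (Fin n) ℝ} (hB : IsUnit B.det) {a : ℝ → Matrix (Fin N) (Fin N) ℝ} {γ : ℝ}
    {D : Set ℝ} (ha : IsWeightOff a γ D) (hA : ∀ t ∉ D, ContinuousAt A t) {t₀ : ℝ} (ht₀ : 0 ≤ t₀)
    {x : ℝ → Fin N → Fin n → ℝ} (hx : IsSolutionOn (closedLoop A B a) (Ici t₀) x) {t : ℝ}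
    (ht : t₀ < t) (htD : t ∉ D) (k : Fin N) :
    HasDerivAt (fun τ => x τ k) (A t *ᵥ x t k + ∑ j, a t k j • (x t j - x t k)) t := by
  have hxc : ∀ k, ContinuousAt (fun τ => x τ k) t :=
    continuousAt_pi.1 (hx.1.continuousAt (Ici_mem_nhds ht))
  have hc : ContinuousAt (fun τ => closedLoop A B a τ (x τ)) t := by
    refine continuousAt_pi.2 fun k => ?_
    simp only [closedLoop_apply hB]
    refine ContinuousAt.add ?_ (tendsto_finsetSum _ fun j _ =>
      (ha.continuousAt t (ht₀.trans_lt ht) htD k j).smul ((hxc j).sub (hxc k)))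
    refine continuousAt_pi.2 fun i => ?_
    simp only [Matrix.mulVec, dotProduct]
    exact tendsto_finsetSum _ fun j _ => (continuousAt_pi.1 (continuousAt_pi.1 (hA t htD) i) j).mul
      (continuousAt_pi.1 (hxc k) j)
  have := hasDerivAt_pi.1 (hx.hasDerivAt ht hc) k
  rwa [closedLoop_apply hB] at this

theorem Matrix.hasDerivAt_apply {n : ℕ} {G : ℝ → Matrix (Fin n) (Fin n) ℝ}
    {G' : Matrix (Fin n) (Fin n) ℝ} {t : ℝ} (hG : HasDerivAt G G' t) (i j : Fin n) :
    HasDerivAt (fun τ => G τ i j) (G' i j) t :=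
  (LinearMap.toContinuousLinearMap (Matrix.entryLinearMap ℝ ℝ i j)).hasFDerivAt.comp_hasDerivAt t hG

/-- In the coordinates that follow the free motion, each component of a solution of the closed loop
solves the scalar consensus system. -/
theorem IsFundamentalPair.isConsensusSolution {N n : ℕ} {A Φ Ψ : ℝ → Matrix (Fin n) (Fin n) ℝ}
    {B : Matrix (Fin n) (Fin n) ℝ} (hB : IsUnit B.det) {a : ℝ → Matrix (Fin N) (Fin N) ℝ} {γ : ℝ}
    {D D' : Set ℝ} (h : IsFundamentalPair A D' Φ Ψ) (hD' : D' ⊆ D) (ha : IsWeightOff a γ D)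
    (hA : ∀ t ∉ D, ContinuousAt A t) {t₀ : ℝ} (ht₀ : 0 ≤ t₀)
    {x : ℝ → Fin N → Fin n → ℝ} (hx : IsSolutionOn (closedLoop A B a) (Ici t₀) x)
    (U : Matrix (Fin n) (Fin n) ℝ) (i : Fin n) :
    IsConsensusSolution a D t₀ (fun t k => ((U * Ψ t) *ᵥ x t k) i) := by
  have hG : Continuous fun t => U * Ψ t := continuous_const.mul h.continuous_right
  refine ⟨fun k => ?_, fun t ht htD k => ?_⟩
  · simp only [Matrix.mulVec, dotProduct]
    refine continuousOn_finsetSum _ fun j _ => ContinuousOn.mul ?_ ?_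
    · exact (((continuous_apply j).comp (continuous_apply i)).comp hG).continuousOn
    · exact continuousOn_pi.1 (continuousOn_pi.1 hx.1 k) j
  · have hGd : HasDerivAt (fun t => U * Ψ t) (U * -(Ψ t * A t)) t :=
      (h.hasDerivAt_right t fun hh => htD (hD' hh)).const_mul U
    have hxd := ha.hasDerivAt_closedLoop hB hA ht₀ hx ht htD k
    have hsum := HasDerivAt.fun_sum (u := Finset.univ) fun j _ =>
      (Matrix.hasDerivAt_apply hGd i j).mul (hasDerivAt_pi.1 hxd j)
    have e : ∑ j, a t k j * (((U * Ψ t) *ᵥ x t j) i - ((U * Ψ t) *ᵥ x t k) i) =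
        ∑ j, ((U * -(Ψ t * A t)) i j * x t k j +
          (U * Ψ t) i j * (A t *ᵥ x t k + ∑ l, a t k l • (x t l - x t k)) j) := by
      -- The drift cancels because Ψ' = -ΨA, and the scalar weights pass through the matrix.
      have e1 : (U * -(Ψ t * A t)) *ᵥ x t k +
          (U * Ψ t) *ᵥ (A t *ᵥ x t k + ∑ l, a t k l • (x t l - x t k)) =
          ∑ j, a t k j • ((U * Ψ t) *ᵥ x t j - (U * Ψ t) *ᵥ x t k) := by
        rw [Matrix.mulVec_add, Matrix.mulVec_mulVec, ← add_assoc, ← Matrix.add_mulVec, mul_neg,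
          mul_assoc U, neg_add_cancel, Matrix.zero_mulVec, zero_add, Matrix.mulVec_sum]
        simp only [Matrix.mulVec_smul, Matrix.mulVec_sub]
      have e2 := congrFun e1 i
      rw [Finset.sum_apply] at e2
      rw [Finset.sum_add_distrib]
      exact e2.symm
    rw [e]
    exact hsum

theorem mainTheorem7 {N n : ℕ}
    (A : ℝ → Matrix (Fin n) (Fin n) ℝ) (T : ℝ) (hT : 0 < T)
    (hA : PiecewiseContinuousOn A univ) (hper : Function.Periodic A T)
    (hexp : ∀ μ : ℂ, IsCharacteristicExponent A T μ → μ.re ≤ 0)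
    (B : Matrix (Fin n) (Fin n) ℝ) (hB : IsUnit B.det)
    (a : ℝ → Matrix (Fin N) (Fin N) ℝ) (η γ : ℝ) (ha : IsAdjacency a η γ)
    (hLpc : PiecewiseContinuousOn (fun t => graphLaplacian (a t)) (Ici 0))
    (hLbd : ∃ C : ℝ, ∀ t, 0 ≤ t → ∀ k j, |graphLaplacian (a t) k j| ≤ C)
    (hconn : UniformlyConnected a) :
    ∃ c > 0, ∃ d > 0, ∀ t₀ : ℝ, 0 ≤ t₀ → ∀ x : ℝ → Fin N → Fin n → ℝ,
      IsSolutionOn (closedLoop A B a) (Ici t₀) x →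
      ∃ x₀ : ℝ → Fin n → ℝ,
        IsSolutionOn (fun t v => A t *ᵥ v) (Ici t₀) x₀ ∧
        (∀ t, t₀ ≤ t →
          stackNorm (fun k => x t k - x₀ t) ≤
            c * Real.exp (-d * (t - t₀)) * stackNorm (fun k => x t₀ k - x₀ t₀)) ∧
        ∀ k, Tendsto (fun t => syncControl B (a t) (x t) k) atTop (𝓝 0) := by
  obtain ⟨Φ, Ψ, hF, hbound⟩ := exists_fundamentalPair_transition_bound hT hA hper hexp
  have hD₁ : {t | ¬ ContinuousAt A t}.Countable := by
    have := hA.countable_discontinuities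
    simpa only [mem_univ, true_and, continuousWithinAt_univ] using this
  set D₁ := {t | ¬ ContinuousAt A t}
  set D := D₁ ∪ {t | t ∈ Ici (0 : ℝ) ∧
    ¬ ContinuousWithinAt (fun t => graphLaplacian (a t)) (Ici 0) t} with hD
  have hAc : ∀ t ∉ D, ContinuousAt A t := fun t ht => not_not.1 fun hh => ht (Or.inl hh)
  have hw : IsWeightOff a γ D := ha.isWeightOff (hD₁.union hLpc.countable_discontinuities)
    fun t ht htD => by
      have : ContinuousWithinAt (fun t => graphLaplacian (a t)) (Ici 0) t :=
        not_not.1 fun hh => htD (Or.inr ⟨ht.le, hh⟩)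
      exact this.continuousAt (Ici_mem_nhds ht)
  obtain ⟨c, hc, d, hd, hcons⟩ := hconn.exists_exponential_consensus hw
  obtain ⟨C, hC, hΦΨ⟩ := hbound (d / 2) (by positivity)
  -- The root converts the sup norm to the Euclidean one, 2 comes from `hspread`, and the summand 1
  -- keeps the constant positive even for n = 0.
  refine ⟨Real.sqrt (N * n) * (C * c * 2) + 1, by positivity, d / 2, by positivity,
    fun t₀ ht₀ x hx => ?_⟩
  -- The choice U = Φ t₀ makes the new coordinates agree with x at t₀. The vector β of limits is
  -- then the initial value of the target solution Φ(t)Ψ(t₀)β.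
  choose β hβ using fun i =>
    hcons t₀ ht₀ _ (hF.isConsensusSolution hB subset_union_left hw hAc ht₀ hx (Φ t₀) i)
  have hx₀ : Φ t₀ *ᵥ (Ψ t₀ *ᵥ β) = β := by
    rw [Matrix.mulVec_mulVec, hF.mul_right, Matrix.one_mulVec]
  set σ := stackNorm fun k => x t₀ k - β with hσ
  have hσ0 : 0 ≤ σ := Real.sqrt_nonneg _
  have hspread : ∀ i k j, ((Φ t₀ * Ψ t₀) *ᵥ x t₀ k) i - ((Φ t₀ * Ψ t₀) *ᵥ x t₀ j) i ≤ 2 * σ := by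
    intro i k j
    rw [hF.mul_right, Matrix.one_mulVec, Matrix.one_mulVec]
    have h1 := (abs_le.1 (abs_le_stackNorm (fun k => x t₀ k - β) k i)).2
    have h2 := (abs_le.1 (abs_le_stackNorm (fun k => x t₀ k - β) j i)).1
    simp only [Pi.sub_apply] at h1 h2
    linarith
  have herr : ∀ t, t₀ ≤ t → ∀ k, ‖x t k - Φ t *ᵥ (Ψ t₀ *ᵥ β)‖ ≤
      C * c * 2 * Real.exp (-(d / 2) * (t - t₀)) * σ := by
    intro t ht k
    have e : x t k - Φ t *ᵥ (Ψ t₀ *ᵥ β) =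
        (Φ t * Ψ t₀) *ᵥ ((Φ t₀ * Ψ t) *ᵥ x t k - β) := by
      rw [Matrix.mulVec_sub, Matrix.mulVec_mulVec, Matrix.mulVec_mulVec]
      have : Φ t * Ψ t₀ * (Φ t₀ * Ψ t) = 1 := by
        rw [mul_assoc, ← mul_assoc (Ψ t₀), hF.mul_left, one_mul, hF.mul_right]
      rw [this, Matrix.one_mulVec]
    have hy : ‖(Φ t₀ * Ψ t) *ᵥ x t k - β‖ ≤ c * Real.exp (-d * (t - t₀)) * (2 * σ) :=
      (pi_norm_le_iff_of_nonneg (by positivity)).2 fun i => hβ i _ (hspread i) t ht k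
    rw [e]
    calc _ ≤ ‖Φ t * Ψ t₀‖ * ‖(Φ t₀ * Ψ t) *ᵥ x t k - β‖ := Matrix.linfty_opNorm_mulVec _ _
      _ ≤ C * Real.exp (d / 2 * (t - t₀)) * (c * Real.exp (-d * (t - t₀)) * (2 * σ)) := by
          gcongr
          exact hΦΨ t₀ t ht₀ ht
      _ = C * c * 2 * (Real.exp (d / 2 * (t - t₀)) * Real.exp (-d * (t - t₀))) * σ := by ring
      _ = _ := by rw [← Real.exp_add]; congr 3; ring
  refine ⟨fun t => Φ t *ᵥ (Ψ t₀ *ᵥ β), hF.isSolutionOn_mulVec hD₁ _ _, fun t ht => ?_,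
    fun k => ?_⟩
  · simp only [hx₀]
    refine (stackNorm_le (by positivity) (herr t ht)).trans ?_
    rw [← hσ]
    have : 0 ≤ Real.exp (-(d / 2) * (t - t₀)) * σ := by positivity
    linarith
  · have hexp0 : Tendsto (fun t => C * c * 2 * Real.exp (-(d / 2) * (t - t₀)) * σ) atTop (𝓝 0) := by
      have h1 : Tendsto (fun t : ℝ => -(d / 2) * (t - t₀)) atTop atBot :=
        (tendsto_atTop_add_const_right _ (-t₀) tendsto_id).const_mul_atTop_of_neg (by linarith)
      simpa using ((Real.tendsto_exp_atBot.comp h1).const_mul (C * c * 2)).mul_const σ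
    have herr0 : ∀ k, Tendsto (fun t => x t k - Φ t *ᵥ (Ψ t₀ *ᵥ β)) atTop (𝓝 0) := fun k =>
      squeeze_zero_norm' ((eventually_ge_atTop t₀).mono fun t ht => herr t ht k) hexp0
    have hdiff : ∀ j, Tendsto (fun t => a t k j • (x t j - x t k)) atTop (𝓝 0) := fun j => by
      have h1 : Tendsto (fun t => x t j - x t k) atTop (𝓝 0) := by
        simpa using (herr0 j).sub (herr0 k)
      have h2 : Tendsto (fun t => γ * ‖x t j - x t k‖) atTop (𝓝 0) := by
        simpa using h1.norm.const_mul γ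
      refine squeeze_zero_norm' ((eventually_ge_atTop 0).mono fun t ht => ?_) h2
      rw [norm_smul, Real.norm_of_nonneg (hw.nonneg t ht k j)]
      exact mul_le_mul_of_nonneg_right (hw.le t ht k j) (norm_nonneg _)
    have hsum : Tendsto (fun t => ∑ j, a t k j • (x t j - x t k)) atTop (𝓝 0) := by
      simpa using tendsto_finsetSum Finset.univ fun j _ => hdiff j
    have hcont : Continuous fun v : Fin n → ℝ => B⁻¹ *ᵥ v :=
      (Matrix.mulVecLin B⁻¹).continuous_of_finiteDimensional
    have h0 := (hcont.tendsto 0).comp hsum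
    rwa [Matrix.mulVec_zero] at h0
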